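/- For a non-square integer $d>1$ let $\varepsilon_d>1$ denote the fundamental unit of the real quadratic field $\mathbb{Q}(\sqrt d)$ and let $N(\varepsilon_d)\in\{\pm1\}$ denote its norm over $\mathbb{Q}$. All square roots below are the non-negative real ones. For a number field $k\subset\mathbb{R}$, $E_k$ denotes the unit group of its ring of integers, and $\langle\cdots\rangle$ denotes the subgroup of $\mathbb{R}^\times$ generated by the listed numbers. **Theorem.** Let $p_1\equiv 1\pmod 8$ and $p_2\equiv 1\pmod 4$ be two distinct prime numbers such that $N(\varepsilon_{p_1p_2})=N(\varepsilon_{2p_1p_2})=-1$. Put $\mathbb{K}=\mathbb{Q}(\sqrt2,\sqrt{p_1},\sqrt{p_2})$, $k_3=\mathbb{Q}(\sqrt2,\sqrt{p_1p_2})$, $n_1=N(\varepsilon_{2p_1})$ and $n_2=N(\varepsilon_{2p_2})$. 1) Assume that $(n_1,n_2)=(-1,-1)$. Then $E_{\mathbb{K}}$ takes one of the following forms: a) $E_{\mathbb{K}}=\langle -1,\varepsilon_2,\varepsilon_{p_1},\varepsilon_{p_2},\sqrt{\varepsilon_2\varepsilon_{p_1}\varepsilon_{2p_1}},\sqrt{\varepsilon_2\varepsilon_{p_2}\varepsilon_{2p_2}},\sqrt{\varepsilon_2\varepsilon_{p_1p_2}\varepsilon_{2p_1p_2}},\sqrt{\varepsilon_{p_1}\varepsilon_{p_2}\varepsilon_{p_1p_2}}\rangle$;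 b) $E_{\mathbb{K}}=\Big\langle -1,\varepsilon_2,\varepsilon_{p_1},\varepsilon_{p_2},\sqrt{\varepsilon_2\varepsilon_{p_1}\varepsilon_{2p_1}},\sqrt{\varepsilon_2\varepsilon_{p_2}\varepsilon_{2p_2}},\sqrt{\varepsilon_{p_1}\varepsilon_{p_2}\varepsilon_{p_1p_2}},\sqrt{\varepsilon_2^{a}\varepsilon_{p_1}^{b}\varepsilon_{p_2}^{c}\varepsilon_{p_1p_2}^{d}\sqrt{\varepsilon_2\varepsilon_{p_1}\varepsilon_{2p_1}}\sqrt{\varepsilon_2\varepsilon_{p_2}\varepsilon_{2p_2}}\sqrt{\varepsilon_2\varepsilon_{p_1p_2}\varepsilon_{2p_1p_2}}}\Big\rangle$ for some $a,b,c,d\in\{0,1\}$ with $(b,c,d)\neq(1,1,1)$. Furthermore, if $E_{\mathbb{K}}$ takes the form b), then $\varepsilon_2\varepsilon_{p_1p_2}\varepsilon_{2p_1p_2}$ is a square in $k_3$. 2) Assume that $(n_1,n_2)=(-1,1)$. Then $$E_{\mathbb{K}}=\langle -1,\varepsilon_2,\varepsilon_{p_1},\varepsilon_{p_2},\sqrt{\varepsilon_{2p_2}},\sqrt{\varepsilon_2\varepsilon_{p_1}\varepsilon_{2p_1}},\sqrt{\varepsilon_2\varepsilon_{p_1p_2}\varepsilon_{2p_1p_2}},\sqrt{\varepsilon_{p_1}\varepsilon_{p_2}\varepsilon_{p_1p_2}}\rangle.$$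 3) Assume that $(n_1,n_2)=(1,1)$. Then $$E_{\mathbb{K}}=\langle -1,\varepsilon_2,\varepsilon_{p_1},\varepsilon_{p_2},\sqrt{\varepsilon_{2p_1}},\sqrt{\varepsilon_{2p_2}},\sqrt{\varepsilon_2\varepsilon_{p_1p_2}\varepsilon_{2p_1p_2}},\sqrt{\varepsilon_{p_1}\varepsilon_{p_2}\varepsilon_{p_1p_2}}\rangle.$$ -/

import Mathlib

open NumberField

noncomputable section

namespace MultiquadUnits

/-- The real quadratic field `ℚ(√d)`, as a subfield of `ℝ`
(a field of degree two over `ℚ` as soon as `d` is not a perfect square). -/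
def quadField (d : ℕ) : IntermediateField ℚ ℝ :=
  IntermediateField.adjoin ℚ {√(d : ℝ)}

/-- The unit group `E_k = (𝓞 k)ˣ` of a real field `k ⊆ ℝ`, viewed as a subgroup of `ℝˣ`. -/
def unitGroup (k : IntermediateField ℚ ℝ) : Subgroup ℝˣ :=
  (Units.map ((algebraMap k ℝ).comp (algebraMap (𝓞 k) k) : 𝓞 k →* ℝ)).range

/-- The subgroup `⟨S⟩` of `ℝˣ` generated by a set `S` of nonzero real numbers. -/
def generatedBy (S : Set ℝ) : Subgroup ℝˣ :=
  Subgroup.closure {u : ℝˣ | (u : ℝ) ∈ S}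

/-- The real number underlying a unit of a real field `k ⊆ ℝ`. -/
def realValue {k : IntermediateField ℚ ℝ} (u : (𝓞 k)ˣ) : ℝ := (((u : 𝓞 k) : k) : ℝ)

/-- `u` is the fundamental unit of `k`: it is the unit greater than `1` such that every unit of `k`
is, up to sign, an integral power of `u`. -/
def IsFundamentalUnit {k : IntermediateField ℚ ℝ} (u : (𝓞 k)ˣ) : Prop :=
  1 < realValue u ∧ ∀ v : (𝓞 k)ˣ, ∃ n : ℤ, v = u ^ n ∨ v = -u ^ n

/-- The fundamental unit of `ℚ(√d)`; it exists and is unique whenever `d` is not a perfect square,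
see `isFundamentalUnit_fundamentalUnit` and `IsFundamentalUnit.unique`. -/
def fundamentalUnit (d : ℕ) : (𝓞 (quadField d))ˣ :=
  Classical.epsilon fun u => IsFundamentalUnit u

/-- `ε_d > 1`, the fundamental unit of `ℚ(√d)` as a real number. -/
def ε (d : ℕ) : ℝ := realValue (fundamentalUnit d)

/-- `N(ε_d)`, the norm of the fundamental unit of `ℚ(√d)` in the extension `ℚ(√d)/ℚ`. -/
def normFundUnit (d : ℕ) : ℚ :=
  Algebra.norm ℚ (((fundamentalUnit d : 𝓞 (quadField d))) : quadField d)

/-- The triquadratic field `𝕂 = ℚ(√2, √p₁, √p₂)`. -/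
def triquadField (p₁ p₂ : ℕ) : IntermediateField ℚ ℝ :=
  IntermediateField.adjoin ℚ {√(2 : ℝ), √(p₁ : ℝ), √(p₂ : ℝ)}

/-- The biquadratic subfield `k₃ = ℚ(√2, √(p₁p₂))` of `𝕂`. -/
def biquadField (p₁ p₂ : ℕ) : IntermediateField ℚ ℝ :=
  IntermediateField.adjoin ℚ {√(2 : ℝ), √((p₁ * p₂ : ℕ) : ℝ)}

/-- `E_𝕂` takes the first form:
`⟨-1, ε₂, ε_{p₁}, ε_{p₂}, √(ε₂ε_{p₁}ε_{2p₁}), √(ε₂ε_{p₂}ε_{2p₂}), √(ε₂ε_{p₁p₂}ε_{2p₁p₂}),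
√(ε_{p₁}ε_{p₂}ε_{p₁p₂})⟩`. -/
def HasFirstForm (p₁ p₂ : ℕ) : Prop :=
  unitGroup (triquadField p₁ p₂) = generatedBy {-1, ε 2, ε p₁, ε p₂,
    √(ε 2 * ε p₁ * ε (2 * p₁)), √(ε 2 * ε p₂ * ε (2 * p₂)),
    √(ε 2 * ε (p₁ * p₂) * ε (2 * p₁ * p₂)), √(ε p₁ * ε p₂ * ε (p₁ * p₂))}

/-- `E_𝕂` takes the second form, for some exponents `a, b, c, d ∈ {0, 1}` with
`(b, c, d) ≠ (1, 1, 1)`. -/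
def HasSecondForm (p₁ p₂ : ℕ) : Prop :=
  ∃ a b c d : ℕ, a ≤ 1 ∧ b ≤ 1 ∧ c ≤ 1 ∧ d ≤ 1 ∧ (b, c, d) ≠ (1, 1, 1) ∧
    unitGroup (triquadField p₁ p₂) = generatedBy {-1, ε 2, ε p₁, ε p₂,
      √(ε 2 * ε p₁ * ε (2 * p₁)), √(ε 2 * ε p₂ * ε (2 * p₂)), √(ε p₁ * ε p₂ * ε (p₁ * p₂)),
      √(ε 2 ^ a * ε p₁ ^ b * ε p₂ ^ c * ε (p₁ * p₂) ^ d *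
        √(ε 2 * ε p₁ * ε (2 * p₁)) * √(ε 2 * ε p₂ * ε (2 * p₂)) *
        √(ε 2 * ε (p₁ * p₂) * ε (2 * p₁ * p₂)))}

theorem realValue_injective {k : IntermediateField ℚ ℝ} :
    Function.Injective (realValue (k := k)) := by
  intro u v h
  exact Units.ext (RingOfIntegers.ext (Subtype.ext h))

theorem realValue_mul {k : IntermediateField ℚ ℝ} (u v : (𝓞 k)ˣ) :
    realValue (u * v) = realValue u * realValue v := rfl

theorem realValue_one {k : IntermediateField ℚ ℝ} : realValue (1 : (𝓞 k)ˣ) = 1 := rfl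

theorem realValue_neg {k : IntermediateField ℚ ℝ} (u : (𝓞 k)ˣ) :
    realValue (-u) = -realValue u := rfl

theorem realValue_inv {k : IntermediateField ℚ ℝ} (u : (𝓞 k)ˣ) :
    realValue u⁻¹ = (realValue u)⁻¹ := by
  apply eq_inv_of_mul_eq_one_left
  rw [← realValue_mul, inv_mul_cancel, realValue_one]

theorem realValue_pow {k : IntermediateField ℚ ℝ} (u : (𝓞 k)ˣ) (n : ℕ) :
    realValue (u ^ n) = realValue u ^ n := by
  induction n with
  | zero => rfl
  | succ n ih => rw [pow_succ, realValue_mul, ih, pow_succ]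

theorem realValue_zpow {k : IntermediateField ℚ ℝ} (u : (𝓞 k)ˣ) (n : ℤ) :
    realValue (u ^ n) = realValue u ^ n := by
  cases n with
  | ofNat n => simp [realValue_pow]
  | negSucc n => simp [zpow_negSucc, realValue_inv, realValue_pow]

theorem IsFundamentalUnit.unique {k : IntermediateField ℚ ℝ} {u v : (𝓞 k)ˣ}
    (hu : IsFundamentalUnit u) (hv : IsFundamentalUnit v) : u = v := by
  have key : ∀ {u v : (𝓞 k)ˣ}, IsFundamentalUnit u → 1 < realValue v →
      realValue u ≤ realValue v := by
    intro u v hu hv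
    obtain ⟨n, hn | hn⟩ := hu.2 v
    · rw [hn, realValue_zpow] at hv ⊢
      have h1 : 0 < n := by
        by_contra h
        exact absurd hv (not_lt.mpr (zpow_le_one_of_nonpos₀ hu.1.le (not_lt.mp h)))
      calc realValue u = realValue u ^ (1 : ℤ) := (zpow_one _).symm
        _ ≤ realValue u ^ n := zpow_le_zpow_right₀ hu.1.le h1
    · rw [hn, realValue_neg, realValue_zpow] at hv
      have := zpow_pos (lt_trans one_pos hu.1) n
      linarith
  exact realValue_injective (le_antisymm (key hu hv.1) (key hv hu.1))

theorem isIntegral_sqrt (d : ℕ) : IsIntegral ℚ (√(d : ℝ)) :=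
  ⟨Polynomial.X ^ 2 - Polynomial.C (d : ℚ), Polynomial.monic_X_pow_sub_C _ two_ne_zero, by simp⟩

theorem finrank_quadField {d : ℕ} (hd : ¬ IsSquare d) :
    Module.finrank ℚ (quadField d) = 2 := by
  rw [quadField, IntermediateField.adjoin.finrank (isIntegral_sqrt d)]
  have hmin : minpoly ℚ (√(d : ℝ)) = Polynomial.X ^ 2 - Polynomial.C (d : ℚ) := by
    refine (minpoly.eq_of_irreducible_of_monic ?_ (by simp)
      (Polynomial.monic_X_pow_sub_C _ two_ne_zero)).symm
    refine X_pow_sub_C_irreducible_of_prime Nat.prime_two fun b hb => hd ?_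
    have : IsSquare (d : ℚ) := ⟨b, by rw [← hb, sq]⟩
    exact Rat.isSquare_natCast_iff.mp this
  rw [hmin, Polynomial.natDegree_X_pow_sub_C]

instance (d : ℕ) : NumberField (quadField d) where
  to_charZero := inferInstance
  to_finiteDimensional := IntermediateField.adjoin.finiteDimensional (isIntegral_sqrt d)

instance (d : ℕ) : IsTotallyReal (quadField d) where
  isReal w := by
    rw [InfinitePlace.isReal_iff, ComplexEmbedding.isReal_iff]
    set φ := w.embedding
    let s : quadField d := ⟨√(d : ℝ), IntermediateField.mem_adjoin_simple_self ℚ _⟩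
    have hs : s ^ 2 = (d : quadField d) := Subtype.ext (by simp [s])
    have h1 : (φ s) ^ 2 = ((√(d : ℝ) : ℝ) : ℂ) ^ 2 := by
      rw [← map_pow, hs, ← Complex.ofReal_pow, Real.sq_sqrt (Nat.cast_nonneg d)]
      simp
    have h2 : (starRingEnd ℂ) (φ s) = φ s := by
      rcases sq_eq_sq_iff_eq_or_eq_neg.mp h1 with h | h <;> simp [h]
    have h3 : (ComplexEmbedding.conjugate φ).toRatAlgHom = φ.toRatAlgHom := by
      apply IntermediateField.algHom_ext_of_eq_adjoin (S := quadField d)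
        (s := {√(d : ℝ)}) (hS := rfl)
      rintro x hx
      obtain rfl : x = √(d : ℝ) := hx
      exact h2
    exact RingHom.ext fun x => DFunLike.congr_fun h3 x

theorem rank_quadField {d : ℕ} (hd : ¬ IsSquare d) : Units.rank (quadField d) = 1 := by
  have h := IsTotallyReal.finrank (quadField d)
  have h0 := IsTotallyReal.nrComplexPlaces_eq_zero (quadField d)
  have h1 := InfinitePlace.card_eq_nrRealPlaces_add_nrComplexPlaces (quadField d)
  rw [finrank_quadField hd] at h
  rw [Units.rank]
  omega

theorem eq_one_or_neg_one_of_mem_torsion {k : IntermediateField ℚ ℝ} {u : (𝓞 k)ˣ}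
    (hu : u ∈ Units.torsion k) : u = 1 ∨ u = -1 := by
  obtain ⟨n, hn, h⟩ := isOfFinOrder_iff_pow_eq_one.mp ((CommGroup.mem_torsion _).mp hu)
  have h1 : |realValue u| ^ n = 1 := by
    rw [← abs_pow, ← realValue_pow, h, realValue_one, abs_one]
  have h2 : |realValue u| = 1 := (pow_eq_one_iff_of_nonneg (abs_nonneg _) hn.ne').mp h1
  rcases (abs_eq one_pos.le).mp h2 with h | h
  · exact Or.inl (realValue_injective h)
  · exact Or.inr (realValue_injective h)

theorem exists_isFundamentalUnit {d : ℕ} (hd : ¬ IsSquare d) :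
    ∃ u : (𝓞 (quadField d))ˣ, IsFundamentalUnit u := by
  have hr := rank_quadField hd
  have hF : ∃ i₀ : Fin (Units.rank (quadField d)), ∀ i, i = i₀ := by
    rw [hr]; exact ⟨0, fun i => Subsingleton.elim _ _⟩
  obtain ⟨i₀, hi₀⟩ := hF
  have : Unique (Fin (Units.rank (quadField d))) := ⟨⟨i₀⟩, hi₀⟩
  set η := Units.fundSystem (quadField d) default with hη
  have hgen : ∀ v : (𝓞 (quadField d))ˣ, ∃ n : ℤ, v = η ^ n ∨ v = -η ^ n := by
    intro v
    obtain ⟨⟨ζ, e⟩, h, -⟩ := Units.exist_unique_eq_mul_prod (quadField d) v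
    rw [Fintype.prod_unique] at h
    refine ⟨e default, ?_⟩
    rcases eq_one_or_neg_one_of_mem_torsion ζ.2 with h1 | h1
    · left; rw [h]; simp only [h1, one_mul]; rfl
    · right; rw [h]; simp only [h1, neg_mul, one_mul]; rfl
  have hne : |realValue η| ≠ 1 := by
    intro h
    have hsq : η ^ 2 = 1 := realValue_injective (by
      rw [realValue_pow, ← sq_abs, h, realValue_one, one_pow])
    obtain ⟨x, -, hx⟩ := Units.exist_unique_eq_mul_prod (quadField d) 1
    have ha := hx (1, 0) (by simp)
    have hb := hx (1, fun _ => 2) (by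
      simp only [Fintype.prod_unique]
      rw [← hη]
      change 1 = 1 * η ^ (2 : ℤ)
      rw [one_mul]; exact_mod_cast hsq.symm)
    have hc := congrFun (congrArg Prod.snd (ha.trans hb.symm)) default
    simp at hc
  have hneg : ∀ (u : (𝓞 (quadField d))ˣ) (n : ℤ), (-u) ^ n = u ^ n ∨ (-u) ^ n = -u ^ n := by
    intro u n
    rcases Int.even_or_odd n with h | h
    · exact Or.inl (h.neg_zpow u)
    · refine Or.inr (realValue_injective ?_)
      rw [realValue_neg, realValue_zpow, realValue_zpow, realValue_neg, h.neg_zpow]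
  -- replacing the generator by its negative or its inverse
  have gneg : ∀ u : (𝓞 (quadField d))ˣ, (∀ v : (𝓞 (quadField d))ˣ, ∃ n : ℤ, v = u ^ n ∨ v = -u ^ n) →
      ∀ v : (𝓞 (quadField d))ˣ, ∃ n : ℤ, v = (-u) ^ n ∨ v = -(-u) ^ n := by
    intro u hu v
    obtain ⟨n, h⟩ := hu v
    refine ⟨n, ?_⟩
    rcases hneg u n with h' | h' <;> rw [h'] <;> [exact h; (rw [neg_neg]; exact h.symm)]
  have ginv : ∀ u : (𝓞 (quadField d))ˣ, (∀ v : (𝓞 (quadField d))ˣ, ∃ n : ℤ, v = u ^ n ∨ v = -u ^ n) →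
      ∀ v : (𝓞 (quadField d))ˣ, ∃ n : ℤ, v = u⁻¹ ^ n ∨ v = -u⁻¹ ^ n := by
    intro u hu v
    obtain ⟨n, h⟩ := hu v
    exact ⟨-n, by simpa using h⟩
  have habs : ∃ θ : (𝓞 (quadField d))ˣ, 0 < realValue θ ∧ realValue θ ≠ 1 ∧
      ∀ v : (𝓞 (quadField d))ˣ, ∃ n : ℤ, v = θ ^ n ∨ v = -θ ^ n := by
    have h0 : realValue η ≠ 0 := fun h => by
      have := realValue_mul η η⁻¹
      rw [mul_inv_cancel, realValue_one, h, zero_mul] at this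
      exact one_ne_zero this
    rcases lt_or_gt_of_ne h0 with h | h
    · refine ⟨-η, by rw [realValue_neg]; linarith, ?_, gneg η hgen⟩
      rwa [realValue_neg, ← abs_of_neg h]
    · exact ⟨η, h, by rwa [← abs_of_pos h], hgen⟩
  obtain ⟨θ, hpos, hθ, hg⟩ := habs
  rcases lt_or_gt_of_ne hθ with h | h
  · exact ⟨θ⁻¹, by rw [realValue_inv]; exact (one_lt_inv₀ hpos).mpr h, ginv θ hg⟩
  · exact ⟨θ, h, hg⟩

theorem isFundamentalUnit_fundamentalUnit {d : ℕ} (hd : ¬ IsSquare d) :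
    IsFundamentalUnit (fundamentalUnit d) :=
  Classical.epsilon_spec (exists_isFundamentalUnit hd)

end MultiquadUnits

end

open MultiquadUnits

/-!
The unit group of `K = ℚ(√2, √p, √q)` is determined by two kinds of elementary arguments.

*Square roots of products of quadratic units lie in `K`.* Let `α > 0` be a unit of `K`, and suppose
that `αx²` is rational for some `x ≠ 0` in `K`. Then `α` is a square in `K`
(`FlipSystem.exists_sq_eq_of_mul_sq_rat`): the conjugates of `x` differ from `x` by units, so only
primes ramified in `K` divide the squarefree part of `αx²`, and `2`, `p`, `q` are squares in `K`.
For `α = ε` of norm `1` one takes `x = 1 + ε⁻¹`; for a product `α = xyz` of the three quadratic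
units of a biquadratic field, all of norm `-1`, one takes `(xyz + x + y - z) / (xyz)`. Here
`ε_2`, `ε_p`, `ε_q` have norm `-1`, the last two because the negative Pell equation is solvable.

*There are no further units, with the exception described in the second form.* For a unit `u > 0` the
product of its norms to the seven quadratic subfields is `u⁴ N(u)³`, so `u⁴` is a power product of
the seven quadratic units (`FlipSystem.exists_pow_four_eq`). As `u⁴` is totally positive, parity
conditions hold for the exponents, and `u²` is a power product of `ε_2, ε_p, ε_q` and of the four
square roots `w₁, w₂, w₃, w₄` found above (`UnitData.exists_sq_eq_prod`). The exponents of the `wᵢ`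
are then restricted by the signs of norms of `u²` to biquadratic
subfields (`UnitData.even_of_sq_eq_prod`); these norms of `u²` are positive, while those of a square
root of a product of three units of norm `-1` may be negative. The exponents of `ε_2, ε_p, ε_q` are
restricted by the signs of the conjugates of `u²` (`UnitData.even_of_sq_eq_prod_zero`). What remains
is the class of `w₁w₂w₃` if `ε_{2p}` and `ε_{2q}` have norm `-1`. A root `w₁ = √ε_{2p}`, which occurs
if the norm is `1`, is excluded since it would lie in `ℚ(√(2p))` (`UnitData.sq_ne_prod`).

In the second form, the norm of the last generator to `ℚ(√2, √(pq))` equals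
`√(ε_2 ε_{pq} ε_{2pq})` up to sign and units of this field (`UnitData.fixed_w₃`).
-/

open MultiquadUnits

namespace MultiquadUnits

/-! ### Units and norms in real quadratic fields -/

theorem mem_unitGroup_iff {k : IntermediateField ℚ ℝ} {u : ℝˣ} :
    u ∈ unitGroup k ↔
      (u : ℝ) ∈ k ∧ IsIntegral ℤ (u : ℝ) ∧ IsIntegral ℤ (u : ℝ)⁻¹ := by
  constructor
  · rintro ⟨v, rfl⟩
    have key : ∀ w : 𝓞 k, IsIntegral ℤ (((w : k) : ℝ)) := fun w =>
      map_isIntegral_int (algebraMap k ℝ) w.2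
    refine ⟨((v : 𝓞 k) : k).2, key v, ?_⟩
    rw [← Units.val_inv_eq_inv_val, ← map_inv]
    exact key ((v⁻¹ : (𝓞 k)ˣ) : 𝓞 k)
  · rintro ⟨hk, h1, h2⟩
    have key : ∀ x : k, IsIntegral ℤ (x : ℝ) → IsIntegral ℤ x := fun x hx =>
      (isIntegral_algebraMap_iff (algebraMap k ℝ).injective).mp hx
    let a : 𝓞 k := ⟨⟨u, hk⟩, key _ h1⟩
    let b : 𝓞 k := ⟨⟨(u : ℝ)⁻¹, k.inv_mem hk⟩, key _ h2⟩
    have hab : a * b = 1 :=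
      RingOfIntegers.ext (Subtype.ext (mul_inv_cancel₀ u.ne_zero))
    exact ⟨⟨a, b, hab, by rw [mul_comm, hab]⟩, Units.ext rfl⟩

section Quadratic

variable {d : ℕ}

theorem one_lt_ε (hd : ¬ IsSquare d) : 1 < ε d := (isFundamentalUnit_fundamentalUnit hd).1

theorem ε_mem_quadField (d : ℕ) : ε d ∈ quadField d :=
  ((fundamentalUnit d : 𝓞 (quadField d)) : quadField d).2

theorem isIntegral_ε (d : ℕ) : IsIntegral ℤ (ε d) :=
  map_isIntegral_int (algebraMap (quadField d) ℝ) (fundamentalUnit d : 𝓞 (quadField d)).2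

theorem isIntegral_ε_inv (d : ℕ) : IsIntegral ℤ (ε d)⁻¹ := by
  rw [ε, ← realValue_inv]
  exact map_isIntegral_int (algebraMap (quadField d) ℝ)
    ((fundamentalUnit d)⁻¹ : (𝓞 (quadField d))ˣ).1.2

theorem exists_eq_ε_zpow (hd : ¬ IsSquare d) {x : ℝ} (h0 : x ≠ 0) (hx : x ∈ quadField d)
    (h1 : IsIntegral ℤ x) (h2 : IsIntegral ℤ x⁻¹) : ∃ n : ℤ, |x| = ε d ^ n := by
  obtain ⟨v, hv⟩ := (mem_unitGroup_iff (u := Units.mk0 x h0)).mpr ⟨hx, h1, h2⟩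
  have hv' : realValue v = x := congrArg Units.val hv
  have hpos : ∀ n : ℤ, 0 < ε d ^ n := fun n => zpow_pos (one_pos.trans (one_lt_ε hd)) n
  obtain ⟨n, h | h⟩ := (isFundamentalUnit_fundamentalUnit hd).2 v
  · refine ⟨n, ?_⟩
    rw [← hv', h, realValue_zpow]
    exact abs_of_pos (hpos n)
  · refine ⟨n, ?_⟩
    rw [← hv', h, realValue_neg, realValue_zpow, abs_neg]
    exact abs_of_pos (hpos n)

/-- A square root of `ε_d` would be a unit smaller than the fundamental one. -/
theorem sq_ne_ε (hd : ¬ IsSquare d) {x : ℝ} (hx : x ∈ quadField d) : x ^ 2 ≠ ε d := by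
  intro h
  have h1 := one_lt_ε hd
  have h0 : x ≠ 0 := by rintro rfl; norm_num at h; linarith
  obtain ⟨n, hn⟩ := exists_eq_ε_zpow hd h0 hx (.of_pow two_pos (h ▸ isIntegral_ε d))
    (.of_pow two_pos (by rw [inv_pow, h]; exact isIntegral_ε_inv d))
  have h2 : ε d ^ (n * 2) = ε d ^ (1 : ℤ) := by
    rw [zpow_mul, ← hn, zpow_one, ← h]; exact_mod_cast sq_abs x
  have := zpow_right_injective₀ (by linarith) h1.ne' h2
  omega

/-- `√d` as an element of `ℚ(√d)`. -/
noncomputable def quadGen (d : ℕ) : quadField d := ⟨√(d : ℝ), IntermediateField.mem_adjoin_simple_self ℚ _⟩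

theorem quadGen_sq (d : ℕ) : quadGen d ^ 2 = (d : quadField d) :=
  Subtype.ext (by simp [quadGen])

/-- The nontrivial automorphism of a real quadratic field. -/
theorem exists_conj_quadField (hd : ¬ IsSquare d) :
    ∃ φ : quadField d ≃ₐ[ℚ] quadField d, φ (quadGen d) = - quadGen d ∧
      (∀ x, ∃ a b : ℚ, x = a + b * quadGen d) ∧
      ∀ x, (Algebra.norm ℚ x : quadField d) = x * φ x := by
  classical
  have : Algebra.IsQuadraticExtension ℚ (quadField d) := ⟨finrank_quadField hd⟩
  have hcard : Fintype.card (quadField d ≃ₐ[ℚ] quadField d) = 2 := by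
    rw [← Nat.card_eq_fintype_card, IsGalois.card_aut_eq_finrank, finrank_quadField hd]
  obtain ⟨φ, hφ⟩ := Fintype.exists_ne_of_one_lt_card (by omega) (1 : quadField d ≃ₐ[ℚ] quadField d)
  have huniv : (Finset.univ : Finset (quadField d ≃ₐ[ℚ] quadField d)) = {1, φ} := by
    symm
    rw [← Finset.card_eq_iff_eq_univ, hcard, Finset.card_pair hφ.symm]
  have hall : ∀ ψ : quadField d ≃ₐ[ℚ] quadField d, ψ = 1 ∨ ψ = φ := fun ψ => by
    simpa [huniv] using Finset.mem_univ ψ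
  have hr := quadGen_sq d
  have hφr : φ (quadGen d) = - quadGen d := by
    have h1 : φ (quadGen d) ^ 2 = quadGen d ^ 2 := by rw [← map_pow, hr, map_natCast]
    rcases sq_eq_sq_iff_eq_or_eq_neg.mp h1 with h | h
    · refine absurd (AlgEquiv.coe_toAlgHom_injective ?_) hφ
      apply IntermediateField.algHom_ext_of_eq_adjoin (S := quadField d) (s := {√(d : ℝ)}) (hS := rfl)
      rintro x hx
      obtain rfl : x = √(d : ℝ) := hx
      exact h
    · exact h
  have hφφ : ∀ x, φ (φ x) = x := by
    intro x
    rcases hall (φ * φ) with h | h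
    · exact DFunLike.congr_fun h x
    · exact absurd (mul_eq_left.mp h) hφ
  have hfix : ∀ x : quadField d, φ x = x → ∃ q : ℚ, (q : quadField d) = x := by
    intro x hx
    have : x ∈ (⊥ : IntermediateField ℚ (quadField d)) := by
      rw [IsGalois.mem_bot_iff_fixed]
      intro ψ
      rcases hall ψ with rfl | rfl
      · rfl
      · exact hx
    obtain ⟨q, hq⟩ := this
    exact ⟨q, by simpa using hq⟩
  refine ⟨φ, hφr, fun x => ?_, fun x => ?_⟩
  · have hd0 : (d : quadField d) ≠ 0 := by
      rw [Nat.cast_ne_zero]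
      rintro rfl
      exact hd ⟨0, rfl⟩
    obtain ⟨a, ha⟩ := hfix ((x + φ x) / 2)
      (by simp only [map_div₀, map_add, hφφ, map_ofNat]; ring)
    obtain ⟨b, hb⟩ := hfix ((x - φ x) * quadGen d / (2 * d))
      (by simp only [map_div₀, map_mul, map_sub, hφφ, map_ofNat, map_natCast, hφr]; ring)
    refine ⟨a, b, ?_⟩
    rw [ha, hb]
    field_simp
    rw [hr]; ring
  · have h := Algebra.norm_eq_prod_automorphisms ℚ x
    rw [huniv, Finset.prod_pair hφ.symm] at h
    simpa using h

theorem conj_ε {K : IntermediateField ℚ ℝ} (hd : ¬ IsSquare d) (σ : K ≃ₐ[ℚ] K) {r e : K}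
    (hr : (r : ℝ) = √(d : ℝ)) (he : (e : ℝ) = ε d) :
    (σ r = r → σ e = e) ∧ (σ r = -r → σ e = (normFundUnit d : K) * e⁻¹) := by
  obtain ⟨φ, hφr, hgen, hnorm⟩ := exists_conj_quadField hd
  obtain ⟨a, b, h1⟩ := hgen ((fundamentalUnit d : 𝓞 (quadField d)) : quadField d)
  have h3 : normFundUnit d = a ^ 2 - d * b ^ 2 := by
    have h := hnorm ((fundamentalUnit d : 𝓞 (quadField d)) : quadField d)
    have h2 := congrArg φ h1
    simp only [map_add, map_mul, map_ratCast, hφr] at h2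
    rw [h2] at h
    have h' : ((normFundUnit d : ℚ) : quadField d) = ((a ^ 2 - d * b ^ 2 : ℚ) : quadField d) := by
      rw [normFundUnit, h]
      push_cast
      linear_combination (a - b * quadGen d) * h1 - (b : quadField d) ^ 2 * quadGen_sq d
    exact_mod_cast h'
  have he' : e = a + b * r := Subtype.ext (by
    rw [he]; push_cast; rw [hr]
    have := congrArg (fun y : quadField d => (y : ℝ)) h1
    simpa [ε, realValue, quadGen] using this)
  have hr2 : r ^ 2 = d := Subtype.ext (by
    push_cast; rw [hr]; exact Real.sq_sqrt (Nat.cast_nonneg d))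
  have he0 : e ≠ 0 := by
    rintro rfl
    have := one_lt_ε hd
    rw [← he] at this
    norm_num at this
  constructor
  · intro h
    rw [he']; simp [h]
  · intro h
    rw [eq_mul_inv_iff_mul_eq₀ he0, h3, he']
    simp only [map_add, map_mul, map_ratCast, h]
    push_cast
    linear_combination (-(b : K) ^ 2) * hr2

theorem normFundUnit_eq_neg_one (hd : ¬ IsSquare d) {x y : ℤ} (h : x ^ 2 - d * y ^ 2 = -1) :
    normFundUnit d = -1 := by
  obtain ⟨φ, hφr, -, hnorm⟩ := exists_conj_quadField hd
  have hr := quadGen_sq d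
  set r := quadGen d
  have hri : IsIntegral ℤ r :=
    .of_pow two_pos (by rw [hr]; exact isIntegral_algebraMap (x := (d : ℤ)))
  have hint : ∀ x : ℤ, IsIntegral ℤ (x + y * r : quadField d) := fun x =>
    (isIntegral_algebraMap (x := x)).add ((isIntegral_algebraMap (x := y)).mul hri)
  have hxy : ((x : quadField d) ^ 2 - d * y ^ 2 = -1) := by
    exact_mod_cast congrArg (Int.cast : ℤ → quadField d) h
  have hv : (x + y * r) * ((-x : ℤ) + y * r) = (1 : quadField d) := by
    push_cast
    linear_combination (y : quadField d) ^ 2 * hr - hxy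
  let v : (𝓞 (quadField d))ˣ := ⟨⟨_, hint x⟩, ⟨_, hint (-x)⟩, RingOfIntegers.ext hv,
    RingOfIntegers.ext ((mul_comm _ _).trans hv)⟩
  have hN : ∀ w : quadField d, Algebra.norm ℚ (-w) = Algebra.norm ℚ w := fun w => by
    have h1 := hnorm (-w)
    have h2 := hnorm w
    rw [map_neg φ, neg_mul_neg, ← h2] at h1
    exact_mod_cast h1
  have hNv : Algebra.norm ℚ (x + y * r) = -1 := by
    have h1 := hnorm (x + y * r)
    simp only [map_add, map_mul, map_intCast, hφr] at h1
    have h2 : (Algebra.norm ℚ (x + y * r) : quadField d) = ((-1 : ℚ) : quadField d) := by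
      rw [h1]; push_cast
      linear_combination (-(y : quadField d) ^ 2) * hr + hxy
    exact_mod_cast h2
  have hu : ∃ n : ℤ, normFundUnit d ^ n = -1 := by
    have hz : ∀ n : ℤ, Algebra.norm ℚ
        (((fundamentalUnit d ^ n : (𝓞 (quadField d))ˣ) : 𝓞 (quadField d)) : quadField d) =
          normFundUnit d ^ n := by
      intro n
      let f : (𝓞 (quadField d))ˣ →* ℚˣ := Units.map
        ((Algebra.norm ℚ).comp (algebraMap (𝓞 (quadField d)) (quadField d)).toMonoidHom)
      have := congrArg Units.val (map_zpow f (fundamentalUnit d) n)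
      rwa [Units.val_zpow_eq_zpow_val] at this
    obtain ⟨n, h | h⟩ := (isFundamentalUnit_fundamentalUnit hd).2 v
    · refine ⟨n, ?_⟩
      rw [← hz, ← h]; exact hNv
    · refine ⟨n, ?_⟩
      rw [← hz, ← hN, ← hNv]
      exact congrArg (fun w : (𝓞 (quadField d))ˣ => Algebra.norm ℚ ((w : 𝓞 (quadField d)) : quadField d)) h.symm
  obtain ⟨n, hn⟩ := hu
  have hn0 : n ≠ 0 := by rintro rfl; norm_num at hn
  have habs : |normFundUnit d| ^ n = 1 := by rw [← abs_zpow, hn]; norm_num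
  have h1 : |normFundUnit d| = 1 :=
    (zpow_left_inj₀ (abs_nonneg _) zero_le_one hn0).mp (by rw [habs, one_zpow])
  rcases (abs_eq one_pos.le).mp h1 with h | h
  · rw [h, one_zpow] at hn; norm_num at hn
  · exact h

end Quadratic

/-- The negative Pell equation `x² - p y² = -1` is solvable for a prime `p ≡ 1 (mod 4)`: from the
fundamental solution `x₁² - 1 = p y₁²`, the coprime numbers `(x₁ ± 1) / 2` are `a²` and `p b²` in
some order, and the order giving `a² - p b² = 1` would yield a smaller solution. -/
theorem exists_negative_pell {p : ℕ} (hp : p.Prime) (h4 : p ≡ 1 [MOD 4]) :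
    ∃ x y : ℤ, x ^ 2 - p * y ^ 2 = -1 := by
  have hns : ¬ IsSquare (p : ℤ) := by
    rw [Int.isSquare_natCast_iff]
    exact hp.prime.not_isSquare
  have hp0 : (0 : ℤ) < p := by exact_mod_cast hp.pos
  obtain ⟨s, hs⟩ := Pell.IsFundamental.exists_of_not_isSquare hp0 hns
  have hs1 := hs.1
  have hs2 := hs.2.1
  have hpell := s.prop
  have hp4 : (p : ℤ) % 4 = 1 := by exact_mod_cast h4
  -- `y` is even and `x` is odd
  have hxodd : s.x % 2 = 1 := by
    by_contra hcon
    obtain ⟨k, hk⟩ : ∃ k, s.x = 2 * k := ⟨s.x / 2, by omega⟩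
    obtain ⟨m, hm⟩ : ∃ m, (p : ℤ) = 4 * m + 1 := ⟨p / 4, by omega⟩
    rcases Int.even_or_odd' s.y with ⟨j, hj | hj⟩ <;> rw [hk, hj] at hpell
    · have : 2 * (2 * k ^ 2 - 2 * p * j ^ 2) = 1 := by linear_combination hpell
      omega
    · have : 4 * (k ^ 2 - p * (j ^ 2 + j) - m) = 2 := by linear_combination hpell + hm
      omega
  obtain ⟨k, hk⟩ : ∃ k, s.x = 2 * k + 1 := ⟨s.x / 2, by omega⟩
  have hyeven : s.y % 2 = 0 := by
    by_contra hcon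
    obtain ⟨j, hj⟩ : ∃ j, s.y = 2 * j + 1 := ⟨s.y / 2, by omega⟩
    obtain ⟨m, hm⟩ : ∃ m, (p : ℤ) = 4 * m + 1 := ⟨p / 4, by omega⟩
    rw [hk, hj] at hpell
    have : 4 * (k ^ 2 + k - p * (j ^ 2 + j) - m) = 1 := by linear_combination hpell + hm
    omega
  obtain ⟨j, hj⟩ : ∃ j, s.y = 2 * j := ⟨s.y / 2, by omega⟩
  have hprod : k * (k + 1) = p * j ^ 2 := by
    rw [hk, hj] at hpell
    linarith [hpell]
  have hk0 : 0 < k := by omega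
  have hj0 : 0 < j := by omega
  have hcop : IsCoprime k (k + 1) := ⟨-1, 1, by ring⟩
  have hpp : Prime (p : ℤ) := Nat.prime_iff_prime_int.mp hp
  have hsq : ∀ a b : ℤ, 0 < a → IsCoprime a b → a * b = j ^ 2 → ∃ c, a = c ^ 2 := by
    intro a b ha hab h
    obtain ⟨c, hc | hc⟩ := Int.sq_of_isCoprime hab h
    · exact ⟨c, hc⟩
    · nlinarith [sq_nonneg c]
  rcases hpp.dvd_or_dvd (Dvd.intro _ hprod.symm) with ⟨l, hl⟩ | ⟨l, hl⟩
  · have hl0 : 0 < l := by nlinarith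
    have h1 : l * (k + 1) = j ^ 2 := by
      apply mul_left_cancel₀ hp0.ne'
      rw [← hprod, hl]; ring
    have hc2 : IsCoprime l (k + 1) := by
      rw [hl] at hcop ⊢
      exact hcop.of_mul_left_right
    obtain ⟨b, hb⟩ := hsq l _ hl0 hc2 h1
    obtain ⟨a, ha⟩ := hsq (k + 1) l (by omega) hc2.symm (by rw [mul_comm]; exact h1)
    have h2 : |a| ^ 2 - p * b ^ 2 = 1 := by
      rw [sq_abs, ← ha, ← hb, ← hl]; ring
    have h3 : 1 < |a| := by
      by_contra hcon
      have : |a| ^ 2 ≤ 1 := by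
        have := abs_nonneg a
        nlinarith
      rw [sq_abs, ← ha] at this
      omega
    have h4 := hs.x_le_x (a := Pell.Solution₁.mk |a| b h2) (by simpa using h3)
    rw [Pell.Solution₁.x_mk, hk] at h4
    have h5 : |a| ^ 2 = k + 1 := by rw [sq_abs, ha]
    nlinarith
  · have hl0 : 0 < l := by nlinarith
    have h1 : k * l = j ^ 2 := by
      apply mul_left_cancel₀ hp0.ne'
      rw [← hprod, hl]; ring
    have hc2 : IsCoprime k l := by
      rw [hl] at hcop
      exact hcop.of_mul_right_right
    obtain ⟨a, ha⟩ := hsq k _ hk0 hc2 h1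
    obtain ⟨b, hb⟩ := hsq l k hl0 hc2.symm (by rw [mul_comm]; exact h1)
    exact ⟨a, b, by rw [← ha, ← hb, ← hl]; ring⟩

/-! ### Automorphisms of the triquadratic field -/

/-- Automorphisms `s₀, s₁, s₂` of a real field `K` containing `r₀ = √2`, `r₁ = √p`, `r₂ = √q`:
they are commuting involutions, `sᵢ` changes the sign of `rᵢ` and fixes the two other roots, and
their only common fixed elements are the rational numbers. Such a system exists for
`K = ℚ(√2, √p, √q)`, see `nonempty_flipSystem`; it is symmetric in `p` and `q`. -/
structure FlipSystem (p q : ℕ) (K : IntermediateField ℚ ℝ) where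
  (s₀ s₁ s₂ : K ≃ₐ[ℚ] K)
  (r₀ r₁ r₂ : K)
  coe_r₀ : (r₀ : ℝ) = √(2 : ℕ)
  coe_r₁ : (r₁ : ℝ) = √p
  coe_r₂ : (r₂ : ℝ) = √q
  s₀_r₀ : s₀ r₀ = -r₀
  s₀_r₁ : s₀ r₁ = r₁
  s₀_r₂ : s₀ r₂ = r₂
  s₁_r₀ : s₁ r₀ = r₀
  s₁_r₁ : s₁ r₁ = -r₁
  s₁_r₂ : s₁ r₂ = r₂
  s₂_r₀ : s₂ r₀ = r₀
  s₂_r₁ : s₂ r₁ = r₁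
  s₂_r₂ : s₂ r₂ = -r₂
  s₀_s₀ : ∀ x, s₀ (s₀ x) = x
  s₁_s₁ : ∀ x, s₁ (s₁ x) = x
  s₂_s₂ : ∀ x, s₂ (s₂ x) = x
  s₁_s₀ : ∀ x, s₁ (s₀ x) = s₀ (s₁ x)
  s₂_s₀ : ∀ x, s₂ (s₀ x) = s₀ (s₂ x)
  s₂_s₁ : ∀ x, s₂ (s₁ x) = s₁ (s₂ x)
  exists_rat : ∀ x, s₀ x = x → s₁ x = x → s₂ x = x → ∃ a : ℚ, x = a

attribute [simp] FlipSystem.s₀_r₀ FlipSystem.s₀_r₁ FlipSystem.s₀_r₂ FlipSystem.s₁_r₀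
  FlipSystem.s₁_r₁ FlipSystem.s₁_r₂ FlipSystem.s₂_r₀ FlipSystem.s₂_r₁ FlipSystem.s₂_r₂
  FlipSystem.s₀_s₀ FlipSystem.s₁_s₁ FlipSystem.s₂_s₂ FlipSystem.s₁_s₀ FlipSystem.s₂_s₀
  FlipSystem.s₂_s₁

instance normal_quadField (d : ℕ) : Normal ℚ (quadField d) := by
  by_cases hd : IsSquare d
  · have : quadField d = ⊥ := by
      obtain ⟨a, rfl⟩ := hd
      rw [quadField, IntermediateField.adjoin_eq_bot_iff]
      rintro x hx
      obtain rfl : x = √((a * a : ℕ) : ℝ) := hx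
      rw [Nat.cast_mul, Real.sqrt_mul_self (Nat.cast_nonneg a)]
      exact natCast_mem _ a
    rw [this]
    exact Normal.of_algEquiv (IntermediateField.botEquiv ℚ ℝ).symm
  · have : Algebra.IsQuadraticExtension ℚ (quadField d) := ⟨finrank_quadField hd⟩
    infer_instance

instance normal_sup (E F : IntermediateField ℚ ℝ) [hE : Normal ℚ E] [hF : Normal ℚ F] :
    Normal ℚ (E ⊔ F : IntermediateField ℚ ℝ) := by
  have : ∀ b : Bool, Normal ℚ (cond b E F : IntermediateField ℚ ℝ) := Bool.rec hF hE
  rw [sup_eq_iSup]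
  exact IntermediateField.normal_iSup _ (h := this)

instance isGalois_triquadField (p q : ℕ) : IsGalois ℚ (triquadField p q) := by
  have : triquadField p q = quadField 2 ⊔ (quadField p ⊔ quadField q) := by
    simp only [triquadField, quadField, ← IntermediateField.adjoin_union]
    rfl
  have hn : Normal ℚ (triquadField p q) := by
    rw [this]; infer_instance
  exact ⟨⟩

instance finiteDimensional_triquadField (p q : ℕ) : FiniteDimensional ℚ (triquadField p q) := by
  have : triquadField p q = quadField 2 ⊔ (quadField p ⊔ quadField q) := by
    simp only [triquadField, quadField, ← IntermediateField.adjoin_union]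
    rfl
  rw [this]; infer_instance

theorem algEquiv_triquadField_ext {p q : ℕ} {σ τ : triquadField p q ≃ₐ[ℚ] triquadField p q}
    {x y z : triquadField p q} (hx : (x : ℝ) = √2) (hy : (y : ℝ) = √p) (hz : (z : ℝ) = √q)
    (h₀ : σ x = τ x) (h₁ : σ y = τ y) (h₂ : σ z = τ z) : σ = τ := by
  apply AlgEquiv.coe_toAlgHom_injective
  apply IntermediateField.algHom_ext_of_eq_adjoin (S := triquadField p q)
    (s := {√(2 : ℝ), √(p : ℝ), √(q : ℝ)}) (hS := rfl)
  have key : ∀ w : ℝ, ∀ hw : w ∈ triquadField p q, (w = √2 ∨ w = √p ∨ w = √q) →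
      σ ⟨w, hw⟩ = τ ⟨w, hw⟩ := by
    rintro w hw (h | h | h)
    · rwa [show (⟨w, hw⟩ : triquadField p q) = x from Subtype.ext (h.trans hx.symm)]
    · rwa [show (⟨w, hw⟩ : triquadField p q) = y from Subtype.ext (h.trans hy.symm)]
    · rwa [show (⟨w, hw⟩ : triquadField p q) = z from Subtype.ext (h.trans hz.symm)]
  rintro w hw
  exact key w _ hw

/-- An element of a Galois extension whose square is rational and which is not rational itself is
negated by half of the automorphisms, so the signs by which they act on it add up to zero. -/
theorem sum_sign_eq_zero {K : Type*} [Field K] [Algebra ℚ K] [FiniteDimensional ℚ K]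
    [IsGalois ℚ K] {x : K} (hx : ∀ a : ℚ, x ≠ algebraMap ℚ K a) {χ : (K ≃ₐ[ℚ] K) → ℚ}
    (hχ : ∀ σ : K ≃ₐ[ℚ] K, σ x = algebraMap ℚ K (χ σ) * x) : ∑ σ, χ σ = 0 := by
  by_contra h
  have hfix : ∑ σ : K ≃ₐ[ℚ] K, σ x ∈ (⊥ : IntermediateField ℚ K) := by
    rw [IsGalois.mem_bot_iff_fixed]
    intro τ
    rw [map_sum]
    exact Fintype.sum_equiv (Equiv.mulLeft τ) _ _ fun σ => rfl
  obtain ⟨a, ha⟩ := hfix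
  simp only [hχ, ← Finset.sum_mul, ← map_sum] at ha
  refine hx (a / ∑ σ, χ σ) ?_
  rw [map_div₀, eq_div_iff, mul_comm]
  · exact ha.symm
  · rwa [Ne, map_eq_zero]

theorem not_isSquare_prime_mul {p m : ℕ} (hp : p.Prime) (hm : ¬ p ∣ m) : ¬ IsSquare (p * m) := by
  rintro ⟨k, hk⟩
  obtain ⟨l, rfl⟩ : p ∣ k := by
    have : p ∣ k * k := Dvd.intro _ hk
    exact (hp.dvd_mul.mp this).elim id id
  refine hm ⟨l * l, mul_left_cancel₀ hp.ne_zero ?_⟩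
  rw [hk]; ring

/-- Every choice of signs of `√2, √p, √q` comes from an automorphism of `ℚ(√2, √p, √q)`. -/
theorem exists_algEquiv_signs {p q : ℕ} (hp : p.Prime) (hq : q.Prime) (hp2 : p ≠ 2) (hq2 : q ≠ 2)
    (hpq : p ≠ q) {x y z : triquadField p q} (hx : (x : ℝ) = √(2 : ℕ)) (hy : (y : ℝ) = √p)
    (hz : (z : ℝ) = √q) {a b c : ℚ} (ha : a ^ 2 = 1) (hb : b ^ 2 = 1) (hc : c ^ 2 = 1) :
    ∃ σ : triquadField p q ≃ₐ[ℚ] triquadField p q, σ x = a * x ∧ σ y = b * y ∧ σ z = c * z := by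
  have sq : ∀ {w : triquadField p q} {d : ℕ}, (w : ℝ) = √d → w ^ 2 = d := fun {w d} h =>
    Subtype.ext (by push_cast; rw [h]; exact Real.sq_sqrt (Nat.cast_nonneg d))
  have sign : ∀ {w : triquadField p q} {d : ℕ}, w ^ 2 = d →
      ∀ σ : triquadField p q ≃ₐ[ℚ] triquadField p q, ∃ s : ℚ, s ^ 2 = 1 ∧ σ w = s * w := by
    intro w d h σ
    have h1 : σ w ^ 2 = w ^ 2 := by rw [← map_pow, h, map_natCast]
    rcases sq_eq_sq_iff_eq_or_eq_neg.mp h1 with h | h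
    · exact ⟨1, by norm_num, by simp [h]⟩
    · exact ⟨-1, by norm_num, by simp [h]⟩
  choose X hX2 hX using sign (sq hx)
  choose Y hY2 hY using sign (sq hy)
  choose Z hZ2 hZ using sign (sq hz)
  -- the seven products of roots are irrational, because their squares are not square numbers
  have irr : ∀ {w : triquadField p q} {d : ℕ}, ¬ IsSquare d → w ^ 2 = d →
      ∀ s : ℚ, w ≠ algebraMap ℚ _ s := by
    rintro w d hd h s rfl
    have : (s ^ 2 : ℚ) = d := (algebraMap ℚ (triquadField p q)).injective (by simpa using h)
    exact hd (Rat.isSquare_natCast_iff.mp ⟨s, by rw [← this, pow_two]⟩)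
  have h2p : ¬ 2 ∣ p := fun h => hp2 ((Nat.prime_dvd_prime_iff_eq Nat.prime_two hp).mp h).symm
  have h2q : ¬ 2 ∣ q := fun h => hq2 ((Nat.prime_dvd_prime_iff_eq Nat.prime_two hq).mp h).symm
  have hpq' : ¬ p ∣ q := fun h => hpq ((Nat.prime_dvd_prime_iff_eq hp hq).mp h)
  have h2pq : ¬ 2 ∣ p * q := fun h => (Nat.prime_two.dvd_mul.mp h).elim h2p h2q
  have sX := sum_sign_eq_zero (irr Nat.prime_two.prime.not_isSquare (sq hx)) hX
  have sY := sum_sign_eq_zero (irr hp.prime.not_isSquare (sq hy)) hY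
  have sZ := sum_sign_eq_zero (irr hq.prime.not_isSquare (sq hz)) hZ
  have sXY := sum_sign_eq_zero (χ := fun σ => X σ * Y σ) (irr (not_isSquare_prime_mul Nat.prime_two h2p)
    (w := x * y) (by rw [mul_pow, sq hx, sq hy]; push_cast; ring))
    (fun σ => by rw [map_mul, hX, hY, eq_ratCast]; push_cast; ring)
  have sXZ := sum_sign_eq_zero (χ := fun σ => X σ * Z σ) (irr (not_isSquare_prime_mul Nat.prime_two h2q)
    (w := x * z) (by rw [mul_pow, sq hx, sq hz]; push_cast; ring))
    (fun σ => by rw [map_mul, hX, hZ, eq_ratCast]; push_cast; ring)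
  have sYZ := sum_sign_eq_zero (χ := fun σ => Y σ * Z σ) (irr (not_isSquare_prime_mul hp hpq')
    (w := y * z) (by rw [mul_pow, sq hy, sq hz]; push_cast; ring))
    (fun σ => by rw [map_mul, hY, hZ, eq_ratCast]; push_cast; ring)
  have sXYZ := sum_sign_eq_zero (χ := fun σ => X σ * (Y σ * Z σ))
    (irr (not_isSquare_prime_mul Nat.prime_two h2pq)
    (w := x * (y * z)) (by rw [mul_pow, mul_pow, sq hx, sq hy, sq hz]; push_cast; ring))
    (fun σ => by rw [map_mul, map_mul, hX, hY, hZ, eq_ratCast]; push_cast; ring)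
  by_contra! hcon
  have hzero : ∀ σ, (1 + a * X σ) * (1 + b * Y σ) * (1 + c * Z σ) = 0 := by
    have key : ∀ {s t : ℚ}, s ^ 2 = 1 → t ^ 2 = 1 → t = s ∨ 1 + s * t = 0 := by
      intro s t hs ht
      rcases sq_eq_sq_iff_eq_or_eq_neg.mp (ht.trans hs.symm) with h | h
      · exact Or.inl h
      · right; rw [h]; linear_combination -hs
    intro σ
    rcases key ha (hX2 σ) with h1 | h1
    · rcases key hb (hY2 σ) with h2 | h2
      · rcases key hc (hZ2 σ) with h3 | h3
        · exact absurd (by rw [hZ, h3]) (hcon σ (by rw [hX, h1]) (by rw [hY, h2]))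
        · rw [h3, mul_zero]
      · rw [h2, mul_zero, zero_mul]
    · rw [h1, zero_mul, zero_mul]
  have hsum : ∑ σ, ((1 : ℚ) + a * X σ + b * Y σ + c * Z σ + a * b * (X σ * Y σ) + a * c * (X σ * Z σ)
      + b * c * (Y σ * Z σ) + a * b * c * (X σ * (Y σ * Z σ))) = 0 :=
    Finset.sum_eq_zero fun σ _ => by rw [← hzero σ]; ring
  simp only [Finset.sum_add_distrib, ← Finset.mul_sum, sX, sY, sZ, sXY, sXZ, sYZ, sXYZ] at hsum
  simp at hsum

theorem nonempty_flipSystem {p q : ℕ} (hp : p.Prime) (hq : q.Prime) (hp2 : p ≠ 2) (hq2 : q ≠ 2)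
    (hpq : p ≠ q) : Nonempty (FlipSystem p q (triquadField p q)) := by
  have hmem : ∀ w ∈ ({√(2 : ℝ), √(p : ℝ), √(q : ℝ)} : Set ℝ), w ∈ triquadField p q :=
    fun w hw => IntermediateField.subset_adjoin ℚ _ hw
  let x : triquadField p q := ⟨√(2 : ℕ), hmem _ (by simp)⟩
  let y : triquadField p q := ⟨√p, hmem _ (by simp)⟩
  let z : triquadField p q := ⟨√q, hmem _ (by simp)⟩
  have hx : (x : ℝ) = √2 := by simp [x]
  have hxx : x ^ 2 = 2 := Subtype.ext (by simp [hx]; rfl)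
  have hyy : y ^ 2 = p := Subtype.ext (by simp [y])
  have hzz : z ^ 2 = q := Subtype.ext (by simp [z])
  have ext : ∀ {σ τ : triquadField p q ≃ₐ[ℚ] triquadField p q}, σ x = τ x → σ y = τ y → σ z = τ z →
    σ = τ := fun h1 h2 h3 => algEquiv_triquadField_ext hx rfl rfl h1 h2 h3
  have ex := fun {a b c : ℚ} => exists_algEquiv_signs hp hq hp2 hq2 hpq (x := x) (y := y) (z := z)
    rfl rfl rfl (a := a) (b := b) (c := c)
  obtain ⟨s₀, h00, h01, h02⟩ := ex (a := -1) (b := 1) (c := 1) (by norm_num) (by norm_num) (by norm_num)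
  obtain ⟨s₁, h10, h11, h12⟩ := ex (a := 1) (b := -1) (c := 1) (by norm_num) (by norm_num) (by norm_num)
  obtain ⟨s₂, h20, h21, h22⟩ := ex (a := 1) (b := 1) (c := -1) (by norm_num) (by norm_num) (by norm_num)
  simp only [Rat.cast_neg, Rat.cast_one, one_mul, neg_mul] at h00 h01 h02 h10 h11 h12 h20 h21 h22
  have inv : ∀ {σ : triquadField p q ≃ₐ[ℚ] triquadField p q}, σ (σ x) = x → σ (σ y) = y →
      σ (σ z) = z → ∀ w, σ (σ w) = w := fun {σ} h1 h2 h3 w =>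
    DFunLike.congr_fun (ext (σ := σ * σ) (τ := 1) h1 h2 h3) w
  have com : ∀ {σ τ : triquadField p q ≃ₐ[ℚ] triquadField p q}, σ (τ x) = τ (σ x) →
      σ (τ y) = τ (σ y) → σ (τ z) = τ (σ z) → ∀ w, σ (τ w) = τ (σ w) := fun {σ τ} h1 h2 h3 w =>
    DFunLike.congr_fun (ext (σ := σ * τ) (τ := τ * σ) h1 h2 h3) w
  refine ⟨⟨s₀, s₁, s₂, x, y, z, rfl, rfl, rfl, h00, h01, h02, h10, h11, h12, h20, h21, h22,
    inv ?_ ?_ ?_, inv ?_ ?_ ?_, inv ?_ ?_ ?_, com ?_ ?_ ?_, com ?_ ?_ ?_, com ?_ ?_ ?_, ?_⟩⟩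
  iterate 18 simp [h00, h01, h02, h10, h11, h12, h20, h21, h22]
  intro w hw0 hw1 hw2
  -- an automorphism is the product of the `sᵢ` over the roots whose sign it changes
  have step : ∀ {v : triquadField p q} {d : ℕ}, v ^ 2 = d →
      ∀ τ : triquadField p q ≃ₐ[ℚ] triquadField p q, τ v = v ∨ τ v = -v := fun {v d} h τ =>
    sq_eq_sq_iff_eq_or_eq_neg.mp (by rw [← map_pow, h, map_natCast])
  have : w ∈ (⊥ : IntermediateField ℚ (triquadField p q)) := by
    rw [IsGalois.mem_bot_iff_fixed]
    intro τ
    have red : ∃ σ ∈ ({1, s₀} : Set (triquadField p q ≃ₐ[ℚ] triquadField p q)),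
        ∃ σ' ∈ ({1, s₁} : Set (triquadField p q ≃ₐ[ℚ] triquadField p q)),
        ∃ σ'' ∈ ({1, s₂} : Set (triquadField p q ≃ₐ[ℚ] triquadField p q)), τ = σ * σ' * σ'' := by
      rcases step (by exact_mod_cast hxx) τ with e1 | e1 <;> rcases step hyy τ with e2 | e2 <;>
        rcases step hzz τ with e3 | e3
      · exact ⟨1, by simp, 1, by simp, 1, by simp, ext (by simp [*]) (by simp [*]) (by simp [*])⟩
      · exact ⟨1, by simp, 1, by simp, s₂, by simp, ext (by simp [*]) (by simp [*]) (by simp [*])⟩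
      · exact ⟨1, by simp, s₁, by simp, 1, by simp, ext (by simp [*]) (by simp [*]) (by simp [*])⟩
      · exact ⟨1, by simp, s₁, by simp, s₂, by simp, ext (by simp [*]) (by simp [*]) (by simp [*])⟩
      · exact ⟨s₀, by simp, 1, by simp, 1, by simp, ext (by simp [*]) (by simp [*]) (by simp [*])⟩
      · exact ⟨s₀, by simp, 1, by simp, s₂, by simp, ext (by simp [*]) (by simp [*]) (by simp [*])⟩
      · exact ⟨s₀, by simp, s₁, by simp, 1, by simp, ext (by simp [*]) (by simp [*]) (by simp [*])⟩
      · exact ⟨s₀, by simp, s₁, by simp, s₂, by simp, ext (by simp [*]) (by simp [*]) (by simp [*])⟩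
    obtain ⟨σ, hσ, σ', hσ', σ'', hσ'', rfl⟩ := red
    have f0 : σ w = w := by rcases hσ with rfl | rfl <;> [rfl; exact hw0]
    have f1 : σ' w = w := by rcases hσ' with rfl | rfl <;> [rfl; exact hw1]
    have f2 : σ'' w = w := by rcases hσ'' with rfl | rfl <;> [rfl; exact hw2]
    rw [AlgEquiv.mul_apply, AlgEquiv.mul_apply, f2, f1, f0]
  obtain ⟨a, ha⟩ := this
  exact ⟨a, by simpa using ha.symm⟩

/-! ### Units that become rational after multiplication by a square -/

variable {K : IntermediateField ℚ ℝ} {p q : ℕ}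

/-- `x` is a unit of the ring of integers of `K`: a nonzero element that is integral together with
its inverse. -/
structure IsIntegralUnit (x : K) : Prop where
  ne_zero : x ≠ 0
  isIntegral : IsIntegral ℤ x
  isIntegral_inv : IsIntegral ℤ x⁻¹

namespace IsIntegralUnit

variable {x y : K}

theorem mul (hx : IsIntegralUnit x) (hy : IsIntegralUnit y) : IsIntegralUnit (x * y) :=
  ⟨mul_ne_zero hx.1 hy.1, hx.2.mul hy.2, by rw [mul_inv]; exact hx.3.mul hy.3⟩

theorem inv (hx : IsIntegralUnit x) : IsIntegralUnit x⁻¹ :=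
  ⟨inv_ne_zero hx.1, hx.3, by rw [inv_inv]; exact hx.2⟩

theorem map (hx : IsIntegralUnit x) (σ : K ≃ₐ[ℚ] K) : IsIntegralUnit (σ x) :=
  ⟨(map_ne_zero σ).mpr hx.1, map_isIntegral_int σ hx.2, by
    rw [← map_inv₀]; exact map_isIntegral_int σ hx.3⟩

theorem of_sq (hx : IsIntegralUnit (x ^ 2)) : IsIntegralUnit x :=
  ⟨fun h => hx.1 (by rw [h]; ring), .of_pow two_pos hx.2,
    .of_pow two_pos (by rw [inv_pow]; exact hx.3)⟩

theorem pow (hx : IsIntegralUnit x) (n : ℕ) : IsIntegralUnit (x ^ n) :=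
  ⟨pow_ne_zero n hx.1, hx.2.pow n, by rw [← inv_pow]; exact hx.3.pow n⟩

theorem zpow (hx : IsIntegralUnit x) (n : ℤ) : IsIntegralUnit (x ^ n) := by
  cases n with
  | ofNat n => simpa using hx.pow n
  | negSucc n => rw [zpow_negSucc]; exact (hx.pow _).inv

theorem coe (hx : IsIntegralUnit x) :
    (x : ℝ) ≠ 0 ∧ IsIntegral ℤ (x : ℝ) ∧ IsIntegral ℤ (x : ℝ)⁻¹ :=
  ⟨fun h => hx.1 (Subtype.ext h), map_isIntegral_int (algebraMap K ℝ) hx.2,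
    map_isIntegral_int (algebraMap K ℝ) hx.3⟩

theorem of_coe (hx : (x : ℝ) ≠ 0) (h1 : IsIntegral ℤ (x : ℝ)) (h2 : IsIntegral ℤ (x : ℝ)⁻¹) :
    IsIntegralUnit x :=
  ⟨fun h => hx (by rw [h]; rfl), (isIntegral_algebraMap_iff (algebraMap K ℝ).injective).mp h1,
    (isIntegral_algebraMap_iff (x := x⁻¹) (algebraMap K ℝ).injective).mp h2⟩

end IsIntegralUnit

theorem exists_int_of_isIntegral {x : K} (hx : IsIntegral ℤ x) {a : ℚ} (ha : x = a) :
    ∃ n : ℤ, x = n := by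
  have h : IsIntegral ℤ a := by
    rw [ha] at hx
    exact (isIntegral_algebraMap_iff (algebraMap ℚ K).injective).mp (by simpa using hx)
  obtain ⟨n, hn⟩ := IsIntegrallyClosed.isIntegral_iff.mp h
  exact ⟨n, by rw [ha, ← hn]; simp⟩

theorem isIntegral_intCast' (n : ℤ) : IsIntegral ℤ (n : K) := isIntegral_algebraMap (x := n)

theorem isIntegral_natCast' (n : ℕ) : IsIntegral ℤ (n : K) := by
  exact_mod_cast isIntegral_intCast' (K := K) n

namespace FlipSystem

theorem sq_of_coe {r : K} {d : ℕ} (h : (r : ℝ) = √d) : r ^ 2 = d :=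
  Subtype.ext (by push_cast; rw [h]; exact Real.sq_sqrt (Nat.cast_nonneg d))

/-- The roles of `p` and `q` exchanged. -/
noncomputable def swap (S : FlipSystem p q K) : FlipSystem q p K :=
  ⟨S.s₀, S.s₂, S.s₁, S.r₀, S.r₂, S.r₁, S.coe_r₀, S.coe_r₂, S.coe_r₁, S.s₀_r₀, S.s₀_r₂, S.s₀_r₁,
    S.s₂_r₀, S.s₂_r₂, S.s₂_r₁, S.s₁_r₀, S.s₁_r₂, S.s₁_r₁, S.s₀_s₀, S.s₂_s₂, S.s₁_s₁, S.s₂_s₀,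
    S.s₁_s₀, fun x => (S.s₂_s₁ x).symm, fun x h0 h1 h2 => S.exists_rat x h0 h2 h1⟩

/-- The sum of the conjugates of `x`, weighted by the character taking the values `e₀, e₁, e₂`
at `s₀, s₁, s₂`. -/
noncomputable def twistedTrace (S : FlipSystem p q K) (e₀ e₁ e₂ : ℤ) (x : K) : K :=
  let y := x + e₀ * S.s₀ x
  let z := y + e₁ * S.s₁ y
  z + e₂ * S.s₂ z

/-- If `x` and all its conjugates differ by units, and the rational `m = αx²`, with `α` a unit, is
divisible by a prime `l`, then so are the twisted traces of `x`, provided that the corresponding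
product `t₀t₁t₂` of roots is prime to `l`. -/
theorem isIntegral_twistedTrace_div (S : FlipSystem p q K) {α x : K} (hα : IsIntegralUnit α) (hx : x ≠ 0) {m l : ℕ}
    (hl : l.Prime) (hm : α * x ^ 2 = (l * m : ℕ)) {e₀ e₁ e₂ : ℤ} (he₀ : e₀ * e₀ = 1)
    (he₁ : e₁ * e₁ = 1) (he₂ : e₂ * e₂ = 1)
    {t : K} {d : ℕ} (hd : ¬ l ∣ d) (ht : t ^ 2 = d) (ht₀ : S.s₀ t = e₀ * t) (ht₁ : S.s₁ t = e₁ * t)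
    (ht₂ : S.s₂ t = e₂ * t) : IsIntegral ℤ (S.twistedTrace e₀ e₁ e₂ x / l) := by
  have E₀ : (e₀ : K) * e₀ = 1 := by exact_mod_cast he₀
  have E₁ : (e₁ : K) * e₁ = 1 := by exact_mod_cast he₁
  have E₂ : (e₂ : K) * e₂ = 1 := by exact_mod_cast he₂
  have hxi : IsIntegral ℤ x := by
    refine .of_pow two_pos ?_
    rw [show x ^ 2 = (l * m : ℕ) * α⁻¹ by rw [← hm]; field_simp [hα.1]]
    exact (isIntegral_natCast' _).mul hα.3
  have hratio : ∀ σ : K ≃ₐ[ℚ] K, IsIntegral ℤ (σ x / x) := by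
    intro σ
    have h1 : σ α * σ x ^ 2 = (l * m : ℕ) := by rw [← map_pow, ← map_mul, hm, map_natCast]
    have h2 : (σ x / x) ^ 2 = α * (σ α)⁻¹ := by
      have := (hα.map σ).1
      field_simp
      linear_combination h1 - hm
    exact .of_pow two_pos (by rw [h2]; exact hα.2.mul (hα.map σ).3)
  have hstep : ∀ (σ : K ≃ₐ[ℚ] K) (e : ℤ) (y : K), IsIntegral ℤ (y / x) →
      IsIntegral ℤ ((y + e * σ y) / x) := by
    intro σ e y hy
    have h3 : (y + e * σ y) / x = y / x + e * (σ (y / x) * (σ x / x)) := by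
      have : σ x ≠ 0 := (map_ne_zero σ).mpr hx
      rw [map_div₀]; field_simp
    rw [h3]
    exact hy.add ((isIntegral_intCast' e).mul ((map_isIntegral_int σ hy).mul (hratio σ)))
  set T := S.twistedTrace e₀ e₁ e₂ x with hT
  have hTx : IsIntegral ℤ (T / x) :=
    hstep S.s₂ e₂ _ (hstep S.s₁ e₁ _ (hstep S.s₀ e₀ x (by rw [div_self hx]; exact isIntegral_one)))
  have hTi : IsIntegral ℤ T := by
    rw [← div_mul_cancel₀ T hx]; exact hTx.mul hxi
  have hti : IsIntegral ℤ t := .of_pow two_pos (by rw [ht]; exact isIntegral_natCast' d)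
  have hl0 : (l : K) ≠ 0 := by exact_mod_cast hl.ne_zero
  have hTT : IsIntegral ℤ (T ^ 2 / l) := by
    have : T ^ 2 / l = m * (α⁻¹ * (T / x) ^ 2) := by
      have := hα.1
      field_simp
      push_cast at hm
      linear_combination T ^ 2 * hm
    rw [this]
    exact (isIntegral_natCast' m).mul (hα.3.mul (hTx.pow 2))
  have a₀ : S.s₀ T = e₀ * T := by
    simp only [hT, twistedTrace, map_add, map_mul, map_intCast, s₀_s₀, s₁_s₀, s₂_s₀, s₂_s₁]
    linear_combination (-(S.s₀ x + e₁ * S.s₀ (S.s₁ x) + e₂ * S.s₀ (S.s₂ x) +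
      e₁ * e₂ * S.s₀ (S.s₁ (S.s₂ x))) : K) * E₀
  have a₁ : S.s₁ T = e₁ * T := by
    simp only [hT, twistedTrace, map_add, map_mul, map_intCast, s₁_s₁, s₁_s₀, s₂_s₀, s₂_s₁]
    linear_combination (-(S.s₁ x + e₀ * S.s₀ (S.s₁ x) + e₂ * S.s₁ (S.s₂ x) +
      e₀ * e₂ * S.s₀ (S.s₁ (S.s₂ x))) : K) * E₁
  have a₂ : S.s₂ T = e₂ * T := by
    simp only [hT, twistedTrace, map_add, map_mul, map_intCast, s₂_s₂, s₁_s₀, s₂_s₀, s₂_s₁]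
    linear_combination (-(S.s₂ x + e₀ * S.s₀ (S.s₂ x) + e₁ * S.s₁ (S.s₂ x) +
      e₀ * e₁ * S.s₀ (S.s₁ (S.s₂ x))) : K) * E₂
  -- `T t` is a rational integer, whose square is divisible by `l`
  obtain ⟨a, ha⟩ := S.exists_rat (T * t)
    (by rw [map_mul, a₀, ht₀]; linear_combination T * t * E₀)
    (by rw [map_mul, a₁, ht₁]; linear_combination T * t * E₁)
    (by rw [map_mul, a₂, ht₂]; linear_combination T * t * E₂)
  obtain ⟨n, hn⟩ := exists_int_of_isIntegral (hTi.mul hti) ha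
  obtain ⟨k, hk⟩ : ∃ k : ℤ, T ^ 2 / l = k := by
    have hd0 : (d : K) ≠ 0 := by
      rw [Nat.cast_ne_zero]; rintro rfl; exact hd (dvd_zero l)
    refine exists_int_of_isIntegral hTT (a := n ^ 2 / (d * l)) ?_
    push_cast
    rw [← hn, mul_pow, ht]
    field_simp
  have hnk : n ^ 2 = l * k * d := by
    have : (n : K) ^ 2 = l * k * d := by
      rw [← hn, ← hk, mul_pow, ht]; field_simp
    exact_mod_cast this
  have hlp : Prime (l : ℤ) := Nat.prime_iff_prime_int.mp hl
  obtain ⟨n', rfl⟩ : (l : ℤ) ∣ n := hlp.dvd_of_dvd_pow ⟨k * d, by rw [hnk]; ring⟩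
  have hk' : (l : ℤ) ∣ k := by
    have h5 : (l : ℤ) ∣ k * d := by
      refine ⟨n' ^ 2, mul_left_cancel₀ hlp.ne_zero ?_⟩
      linear_combination -hnk
    exact (hlp.dvd_or_dvd h5).resolve_right fun h => hd (by exact_mod_cast h)
  obtain ⟨k', rfl⟩ := hk'
  refine .of_pow two_pos ?_
  have : (T / l) ^ 2 = k' := by
    rw [div_eq_iff hl0] at hk
    rw [div_pow, hk]; push_cast; field_simp
  rw [this]
  exact isIntegral_intCast' k'

theorem not_prime_mul_of_squarefree (S : FlipSystem p q K) (hp : p.Prime) (hq : q.Prime) {α x : K}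
    (hα : IsIntegralUnit α) (hx : x ≠ 0) {m l : ℕ} (hm : α * x ^ 2 = (l * m : ℕ))
    (hl : l.Prime) (hlm : ¬ l ∣ m) : l = 2 ∨ l = p ∨ l = q := by
  by_contra! hne
  obtain ⟨hl2, hlp, hlq⟩ := hne
  have n2 : ¬ l ∣ 2 := fun h => hl2 ((Nat.prime_dvd_prime_iff_eq hl Nat.prime_two).mp h)
  have np : ¬ l ∣ p := fun h => hlp ((Nat.prime_dvd_prime_iff_eq hl hp).mp h)
  have nq : ¬ l ∣ q := fun h => hlq ((Nat.prime_dvd_prime_iff_eq hl hq).mp h)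
  have hl0 : (l : K) ≠ 0 := by exact_mod_cast hl.ne_zero
  -- for each character there is a product of roots on which the automorphisms act through it
  have key : ∀ e₀ ∈ ({1, -1} : Set ℤ), ∀ e₁ ∈ ({1, -1} : Set ℤ), ∀ e₂ ∈ ({1, -1} : Set ℤ),
      IsIntegral ℤ (S.twistedTrace e₀ e₁ e₂ x / l) := by
    have one : ∀ {e : ℤ}, e ∈ ({1, -1} : Set ℤ) → e * e = 1 := by
      rintro e (rfl | rfl) <;> norm_num
    intro e₀ h₀ e₁ h₁ e₂ h₂
    obtain ⟨u, a, ua, la, u0, u1, u2⟩ : ∃ (u : K) (a : ℕ), u ^ 2 = a ∧ ¬ l ∣ a ∧ S.s₀ u = e₀ * u ∧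
        S.s₁ u = u ∧ S.s₂ u = u := by
      rcases h₀ with rfl | rfl
      · exact ⟨1, 1, by simp, hl.one_lt.ne' ∘ Nat.dvd_one.mp, by simp, by simp, by simp⟩
      · exact ⟨S.r₀, 2, sq_of_coe S.coe_r₀, n2, by simp, by simp, by simp⟩
    obtain ⟨v, b, vb, lb, v0, v1, v2⟩ : ∃ (v : K) (b : ℕ), v ^ 2 = b ∧ ¬ l ∣ b ∧ S.s₀ v = v ∧
        S.s₁ v = e₁ * v ∧ S.s₂ v = v := by
      rcases h₁ with rfl | rfl
      · exact ⟨1, 1, by simp, hl.one_lt.ne' ∘ Nat.dvd_one.mp, by simp, by simp, by simp⟩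
      · exact ⟨S.r₁, p, sq_of_coe S.coe_r₁, np, by simp, by simp, by simp⟩
    obtain ⟨w, c, wc, lc, w0, w1, w2⟩ : ∃ (w : K) (c : ℕ), w ^ 2 = c ∧ ¬ l ∣ c ∧ S.s₀ w = w ∧
        S.s₁ w = w ∧ S.s₂ w = e₂ * w := by
      rcases h₂ with rfl | rfl
      · exact ⟨1, 1, by simp, hl.one_lt.ne' ∘ Nat.dvd_one.mp, by simp, by simp, by simp⟩
      · exact ⟨S.r₂, q, sq_of_coe S.coe_r₂, nq, by simp, by simp, by simp⟩
    refine S.isIntegral_twistedTrace_div hα hx hl hm (one h₀) (one h₁) (one h₂)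
      (t := u * v * w) (d := a * b * c) ?_ ?_ ?_ ?_ ?_
    · rw [hl.dvd_mul, hl.dvd_mul]; tauto
    · push_cast; rw [mul_pow, mul_pow, ua, vb, wc]
    · rw [map_mul, map_mul, u0, v0, w0]; ring
    · rw [map_mul, map_mul, u1, v1, w1]; ring
    · rw [map_mul, map_mul, u2, v2, w2]; ring
  have h8 : IsIntegral ℤ (8 * x / l) := by
    have hs : ∀ {y z : K}, IsIntegral ℤ (y / l) → IsIntegral ℤ (z / l) → IsIntegral ℤ ((y + z) / l) :=
      fun h1 h2 => by rw [add_div]; exact h1.add h2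
    have m1 : (1 : ℤ) ∈ ({1, -1} : Set ℤ) := by simp
    have m2 : (-1 : ℤ) ∈ ({1, -1} : Set ℤ) := by simp
    have := hs (hs (hs (key 1 m1 1 m1 1 m1) (key 1 m1 1 m1 (-1) m2))
      (hs (key 1 m1 (-1) m2 1 m1) (key 1 m1 (-1) m2 (-1) m2)))
      (hs (hs (key (-1) m2 1 m1 1 m1) (key (-1) m2 1 m1 (-1) m2))
      (hs (key (-1) m2 (-1) m2 1 m1) (key (-1) m2 (-1) m2 (-1) m2)))
    convert this using 2
    simp only [twistedTrace, map_add, map_mul, map_intCast]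
    push_cast
    ring
  have h64 : IsIntegral ℤ (α * (8 * x / l) ^ 2) := hα.2.mul (h8.pow 2)
  have hval : α * (8 * x / l) ^ 2 = (64 * m / l : ℚ) := by
    push_cast at hm ⊢
    field_simp
    linear_combination 64 * hm
  obtain ⟨n, hn⟩ := exists_int_of_isIntegral h64 hval
  have : (64 * m : ℤ) = l * n := by
    have h : (64 * m : K) = l * n := by
      rw [← hn, hval]; push_cast; field_simp
    exact_mod_cast h
  have hdvd : l ∣ 64 * m := by
    have : (l : ℤ) ∣ ((64 * m : ℕ) : ℤ) := ⟨n, by push_cast; exact this⟩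
    exact_mod_cast this
  rcases hl.dvd_mul.mp hdvd with h | h
  · exact n2 (hl.dvd_of_dvd_pow (show l ∣ 2 ^ 6 from h))
  · exact hlm h

/-- If a positive unit `α` of `𝓞 K` becomes rational after multiplication by a nonzero square, then
it is a square: the squarefree part of this rational number involves ramified primes only, and these
are squares in `K`. -/
theorem exists_sq_eq_of_mul_sq_rat (S : FlipSystem p q K) (hp : p.Prime) (hq : q.Prime) {α x : K}
    (hα : IsIntegralUnit α) (hpos : 0 < (α : ℝ)) (hx : x ≠ 0) {a : ℚ} (ha : α * x ^ 2 = a) :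
    ∃ z : K, 0 < (z : ℝ) ∧ z ^ 2 = α := by
  have hapos : 0 < a := by
    have h := congrArg (fun y : K => (y : ℝ)) ha
    have hx' : (x : ℝ) ≠ 0 := fun h => hx (Subtype.ext h)
    have h2 : (a : ℝ) = α * x ^ 2 := by simpa using h.symm
    have : (0 : ℝ) < a := by rw [h2]; positivity
    exact_mod_cast this
  obtain ⟨m, b, hmb, hm⟩ := Nat.sq_mul_squarefree (a.num.toNat * a.den)
  have hb0 : b ≠ 0 := by
    rintro rfl
    have h1 : a.num.toNat ≠ 0 := by
      have := Rat.num_pos.mpr hapos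
      omega
    exact mul_ne_zero h1 a.den_ne_zero (by rw [← hmb]; ring)
  have hbK : (b : K) ≠ 0 := by exact_mod_cast hb0
  have hden : (a.den : K) ≠ 0 := by exact_mod_cast a.den_ne_zero
  set y := x * a.den / b with hy
  have hy0 : y ≠ 0 := div_ne_zero (mul_ne_zero hx hden) hbK
  have hym : α * y ^ 2 = (m : ℕ) := by
    have h1 : (b ^ 2 * m : ℚ) = a * a.den ^ 2 := by
      have h2 : ((a.num.toNat : ℕ) : ℚ) = a.num := by
        have : ((a.num.toNat : ℕ) : ℤ) = a.num := Int.toNat_of_nonneg (Rat.num_pos.mpr hapos).le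
        exact_mod_cast this
      have h3 : (b ^ 2 * m : ℚ) = a.num.toNat * a.den := by exact_mod_cast hmb
      rw [h3, h2, ← Rat.mul_den_eq_num]; ring
    have h4 : (b ^ 2 * m : K) = a * a.den ^ 2 := by exact_mod_cast congrArg (Rat.cast : ℚ → K) h1
    rw [hy]
    field_simp
    rw [mul_comm ((b : K) ^ 2)] at h4
    linear_combination (a.den : K) ^ 2 * ha - h4
  have hsq : IsSquare (m : K) := by
    rw [← Nat.prod_primeFactors_of_squarefree hm]
    push_cast
    refine Finset.prod_induction _ IsSquare (fun _ _ => IsSquare.mul) (IsSquare.one) fun l hl => ?_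
    obtain ⟨m', rfl⟩ := Nat.dvd_of_mem_primeFactors hl
    have hlp := Nat.prime_of_mem_primeFactors hl
    have hlm : ¬ l ∣ m' := fun h => by
      have := hm l (mul_dvd_mul_left l h)
      exact hlp.one_lt.ne' (Nat.isUnit_iff.mp this)
    rcases S.not_prime_mul_of_squarefree hp hq hα hy0 hym hlp hlm with rfl | rfl | rfl
    · exact ⟨S.r₀, by rw [← pow_two, sq_of_coe S.coe_r₀]⟩
    · exact ⟨S.r₁, by rw [← pow_two, sq_of_coe S.coe_r₁]⟩
    · exact ⟨S.r₂, by rw [← pow_two, sq_of_coe S.coe_r₂]⟩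
  obtain ⟨t, ht⟩ := hsq
  have hz : (t / y) ^ 2 = α := by
    rw [div_pow, div_eq_iff (pow_ne_zero 2 hy0), hym, ht, pow_two]
  have hz0 : ((t / y : K) : ℝ) ≠ 0 := by
    intro h
    rw [show t / y = 0 from Subtype.ext h] at hz
    exact hα.1 (by rw [← hz]; ring)
  rcases lt_or_gt_of_ne hz0 with h | h
  · exact ⟨-(t / y), by simpa using h, by rw [neg_sq, hz]⟩
  · exact ⟨t / y, h, hz⟩

end FlipSystem

/-! ### Squares, fixed fields and fourth powers of units -/

namespace FlipSystem

/-- `σ` replaces an even number of the three elements `x, y, z` by their negative inverses. -/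
def FlipsEven (σ : K ≃ₐ[ℚ] K) (x y z : K) : Prop :=
  (σ x = x ∧ σ y = y ∧ σ z = z) ∨ (σ x = -x⁻¹ ∧ σ y = -y⁻¹ ∧ σ z = z) ∨
    (σ x = -x⁻¹ ∧ σ y = y ∧ σ z = -z⁻¹) ∨ (σ x = x ∧ σ y = -y⁻¹ ∧ σ z = -z⁻¹)

/-- The product of three units of norm `-1` of the quadratic subfields of a biquadratic field is
a square: multiplied by the square of `(xyz + x + y - z) / (xyz)`, it becomes invariant under all
automorphisms. -/
theorem exists_sq_eq_mul_mul (S : FlipSystem p q K) (hp : p.Prime) (hq : q.Prime) {x y z : K}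
    (hx : IsIntegralUnit x) (hy : IsIntegralUnit y) (hz : IsIntegralUnit z)
    (hx1 : 1 < (x : ℝ)) (hy1 : 1 < (y : ℝ)) (hz1 : 1 < (z : ℝ)) (h₀ : FlipsEven S.s₀ x y z)
    (h₁ : FlipsEven S.s₁ x y z) (h₂ : FlipsEven S.s₂ x y z) :
    ∃ w : K, 0 < (w : ℝ) ∧ w ^ 2 = x * y * z := by
  have hx0 := hx.1
  have hy0 := hy.1
  have hz0 := hz.1
  set g := (x * y * z + x + y - z) / (x * y * z) with hg
  have hg0 : g ≠ 0 := by
    refine div_ne_zero (fun h => ?_) (mul_ne_zero (mul_ne_zero hx0 hy0) hz0)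
    have h' := congrArg (fun w : K => (w : ℝ)) h
    have h'' : (x : ℝ) * y * z + x + y - z = 0 := h'
    have h1 : 1 < (x : ℝ) * y := one_lt_mul_of_lt_of_le hx1 hy1.le
    nlinarith
  have hinv : ∀ σ : K ≃ₐ[ℚ] K, FlipsEven σ x y z → σ (x * y * z * g ^ 2) = x * y * z * g ^ 2 := by
    rintro σ (⟨h1, h2, h3⟩ | ⟨h1, h2, h3⟩ | ⟨h1, h2, h3⟩ | ⟨h1, h2, h3⟩) <;>
      simp only [hg, map_mul, map_pow, map_div₀, map_add, map_sub, h1, h2, h3] <;> field_simp <;> ring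
  obtain ⟨a, ha⟩ := S.exists_rat _ (hinv _ h₀) (hinv _ h₁) (hinv _ h₂)
  refine S.exists_sq_eq_of_mul_sq_rat hp hq ((hx.mul hy).mul hz) ?_ hg0 ha
  push_cast
  positivity

/-- A unit of norm `1` of a quadratic subfield is a square. -/
theorem exists_sq_eq_of_norm_one (S : FlipSystem p q K) (hp : p.Prime) (hq : q.Prime) {x : K}
    (hx : IsIntegralUnit x) (hx1 : 1 < (x : ℝ)) (h₀ : S.s₀ x = x ∨ S.s₀ x = x⁻¹)
    (h₁ : S.s₁ x = x ∨ S.s₁ x = x⁻¹) (h₂ : S.s₂ x = x ∨ S.s₂ x = x⁻¹) :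
    ∃ w : K, 0 < (w : ℝ) ∧ w ^ 2 = x := by
  have hx0 := hx.1
  set g := 1 + x⁻¹ with hg
  have hg0 : g ≠ 0 := fun h => by
    have h' := congrArg (fun w : K => (w : ℝ)) h
    simp only [hg, IntermediateField.coe_add, IntermediateField.coe_one, IntermediateField.coe_inv,
      IntermediateField.coe_zero] at h'
    have : 0 < (x : ℝ)⁻¹ := by positivity
    linarith
  have hinv : ∀ σ : K ≃ₐ[ℚ] K, (σ x = x ∨ σ x = x⁻¹) → σ (x * g ^ 2) = x * g ^ 2 := by
    rintro σ (h | h)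
    · simp only [hg, map_mul, map_pow, map_add, map_one, map_inv₀, h]
    · simp only [hg, map_mul, map_pow, map_add, map_one, map_inv₀, h]
      field_simp
      ring
  obtain ⟨a, ha⟩ := S.exists_rat _ (hinv _ h₀) (hinv _ h₁) (hinv _ h₂)
  exact S.exists_sq_eq_of_mul_sq_rat hp hq hx (by positivity) hg0 ha

/-- `σ` either fixes `r, v, v'`, or negates `r` and exchanges `v` and `v'`. -/
def Swaps (σ : K ≃ₐ[ℚ] K) (r v v' : K) : Prop :=
  (σ r = r ∧ σ v = v ∧ σ v' = v') ∨ (σ r = -r ∧ σ v = v' ∧ σ v' = v)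

/-- An element whose conjugates depend only on the sign of the conjugate of `√d` lies in `ℚ(√d)`. -/
theorem mem_quadField_of_swaps (S : FlipSystem p q K) {d : ℕ} (hd : d ≠ 0) {r v v' : K}
    (hr : (r : ℝ) = √d) (h₀ : Swaps S.s₀ r v v') (h₁ : Swaps S.s₁ r v v')
    (h₂ : Swaps S.s₂ r v v') : (v : ℝ) ∈ quadField d := by
  have hr2 := sq_of_coe hr
  have hdK : (d : K) ≠ 0 := by exact_mod_cast hd
  have hadd : ∀ σ : K ≃ₐ[ℚ] K, Swaps σ r v v' → σ (v + v') = v + v' := by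
    rintro σ (⟨-, h2, h3⟩ | ⟨-, h2, h3⟩) <;> rw [map_add, h2, h3]
    rw [add_comm]
  have hsub : ∀ σ : K ≃ₐ[ℚ] K, Swaps σ r v v' → σ ((v - v') * r) = (v - v') * r := by
    rintro σ (⟨h1, h2, h3⟩ | ⟨h1, h2, h3⟩) <;> rw [map_mul, map_sub, h1, h2, h3]
    ring
  obtain ⟨a, ha⟩ := S.exists_rat _ (hadd _ h₀) (hadd _ h₁) (hadd _ h₂)
  obtain ⟨b, hb⟩ := S.exists_rat _ (hsub _ h₀) (hsub _ h₁) (hsub _ h₂)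
  have hv : v = (a / 2 : ℚ) + (b / (2 * d) : ℚ) * r := by
    push_cast
    field_simp
    linear_combination (d : K) * ha + r * hb - (v - v') * hr2
  have hv' : (v : ℝ) = (a / 2 : ℚ) + (b / (2 * d) : ℚ) * √d := by
    rw [← hr]
    exact (congrArg (fun w : K => (w : ℝ)) hv)
  rw [hv']
  exact add_mem ((quadField d).algebraMap_mem (a / 2))
    (mul_mem ((quadField d).algebraMap_mem (b / (2 * d))) (quadGen d).2)

theorem coe_r₀_mul_r₁ (S : FlipSystem p q K) : ((S.r₀ * S.r₁ : K) : ℝ) = √(2 * p : ℕ) := by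
  push_cast
  rw [S.coe_r₀, S.coe_r₁, Real.sqrt_mul zero_le_two]; norm_num

theorem coe_r₁_mul_r₂ (S : FlipSystem p q K) : ((S.r₁ * S.r₂ : K) : ℝ) = √(p * q : ℕ) := by
  push_cast
  rw [S.coe_r₂, S.coe_r₁, Real.sqrt_mul (Nat.cast_nonneg p)]

theorem coe_r₀_mul_r₁_mul_r₂ (S : FlipSystem p q K) :
    ((S.r₀ * S.r₁ * S.r₂ : K) : ℝ) = √(2 * p * q : ℕ) := by
  rw [IntermediateField.coe_mul, coe_r₀_mul_r₁, S.coe_r₂, Nat.cast_mul (2 * p) q,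
    Real.sqrt_mul (Nat.cast_nonneg _)]

/-- The elements fixed by the automorphism `s₁s₂` lie in `ℚ(√2, √(pq))`. -/
theorem mem_biquadField (S : FlipSystem p q K) (hp : p ≠ 0) (hq : q ≠ 0) {v : K}
    (hv : S.s₁ (S.s₂ v) = v) : (v : ℝ) ∈ biquadField p q := by
  have hle : quadField (p * q) ≤ biquadField p q :=
    IntermediateField.adjoin.mono _ _ _ (by simp)
  have h2 : (S.r₀ : ℝ) ∈ biquadField p q := by
    rw [S.coe_r₀]
    exact IntermediateField.subset_adjoin ℚ _ (by simp)
  have hv12 : S.s₂ v = S.s₁ v := by rw [← S.s₁_s₁ (S.s₂ v), hv]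
  have A := hle (S.mem_quadField_of_swaps (v := v + S.s₀ v) (v' := S.s₁ v + S.s₀ (S.s₁ v))
    (mul_ne_zero hp hq) S.coe_r₁_mul_r₂ (.inl ⟨by simp, by simp [add_comm], by simp [add_comm]⟩)
    (.inr ⟨by simp, by simp, by simp⟩) (.inr ⟨by simp, by simp [hv12], by simp [hv12]⟩))
  have B := hle (S.mem_quadField_of_swaps (v := (v - S.s₀ v) * S.r₀)
    (v' := (S.s₁ v - S.s₀ (S.s₁ v)) * S.r₀)
    (mul_ne_zero hp hq) S.coe_r₁_mul_r₂
    (.inl ⟨by simp, by simp; ring, by simp; ring⟩)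
    (.inr ⟨by simp, by simp, by simp⟩) (.inr ⟨by simp, by simp [hv12], by simp [hv12]⟩))
  have hr0 : (S.r₀ : ℝ) ≠ 0 := by rw [S.coe_r₀]; positivity
  have : (v : ℝ) = ((v + S.s₀ v : K) + ((v - S.s₀ v) * S.r₀ : K) * (S.r₀ : ℝ)⁻¹) / 2 := by
    push_cast
    field_simp
    ring
  rw [this]
  exact div_mem (add_mem A (mul_mem B (inv_mem h2))) (natCast_mem _ 2)

/-- A fourth power of a unit is, up to sign, a product of units of the seven quadratic subfields:
the norms `N_F(u)` to these subfields `F` satisfy `∏ N_F(u) = u⁴ N(u)³`. -/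
theorem exists_pow_four_eq (S : FlipSystem p q K) (hp : p.Prime) (hq : q.Prime) (hp2 : p ≠ 2)
    (hq2 : q ≠ 2) (hpq : p ≠ q) {u : K} (hu : IsIntegralUnit u) :
    ∃ n₀ n₁ n₂ n₀₁ n₀₂ n₁₂ n₀₁₂ : ℤ, |(u : ℝ)| ^ 4 =
      ε 2 ^ n₀ * ε p ^ n₁ * ε q ^ n₂ * ε (2 * p) ^ n₀₁ * ε (2 * q) ^ n₀₂ * ε (p * q) ^ n₁₂ *
        ε (2 * p * q) ^ n₀₁₂ := by
  have h2p : ¬ 2 ∣ p := fun h => hp2 ((Nat.prime_dvd_prime_iff_eq Nat.prime_two hp).mp h).symm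
  have h2q : ¬ 2 ∣ q := fun h => hq2 ((Nat.prime_dvd_prime_iff_eq Nat.prime_two hq).mp h).symm
  have hpq' : ¬ p ∣ q := fun h => hpq ((Nat.prime_dvd_prime_iff_eq hp hq).mp h)
  have h2pq : ¬ 2 ∣ p * q := fun h => (Nat.prime_two.dvd_mul.mp h).elim h2p h2q
  have key : ∀ {d : ℕ} {r v : K} (v' : K), ¬ IsSquare d → (r : ℝ) = √d → IsIntegralUnit v →
      Swaps S.s₀ r v v' → Swaps S.s₁ r v v' → Swaps S.s₂ r v v' →
      ∃ n : ℤ, |(v : ℝ)| = ε d ^ n := by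
    intro d r v v' hd hr hv h0 h1 h2
    obtain ⟨c0, c1, c2⟩ := hv.coe
    have hd0 : d ≠ 0 := by rintro rfl; exact hd ⟨0, rfl⟩
    exact exists_eq_ε_zpow hd c0 (S.mem_quadField_of_swaps hd0 hr h0 h1 h2) c1 c2
  obtain ⟨a, ha⟩ : ∃ a, a = S.s₀ u := ⟨_, rfl⟩
  obtain ⟨b, hb⟩ : ∃ b, b = S.s₁ u := ⟨_, rfl⟩
  obtain ⟨c, hc⟩ : ∃ c, c = S.s₂ u := ⟨_, rfl⟩
  obtain ⟨ab, hab⟩ : ∃ x, x = S.s₀ (S.s₁ u) := ⟨_, rfl⟩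
  obtain ⟨ac, hac⟩ : ∃ x, x = S.s₀ (S.s₂ u) := ⟨_, rfl⟩
  obtain ⟨bc, hbc⟩ : ∃ x, x = S.s₁ (S.s₂ u) := ⟨_, rfl⟩
  obtain ⟨abc, habc⟩ : ∃ x, x = S.s₀ (S.s₁ (S.s₂ u)) := ⟨_, rfl⟩
  have ua : IsIntegralUnit a := ha ▸ hu.map _
  have ub : IsIntegralUnit b := hb ▸ hu.map _
  have uc : IsIntegralUnit c := hc ▸ hu.map _
  have uab : IsIntegralUnit ab := hab ▸ (hu.map _).map _
  have uac : IsIntegralUnit ac := hac ▸ (hu.map _).map _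
  have ubc : IsIntegralUnit bc := hbc ▸ (hu.map _).map _
  have uabc : IsIntegralUnit abc := habc ▸ ((hu.map _).map _).map _
  have A : S.s₀ u = a ∧ S.s₀ a = u ∧ S.s₀ b = ab ∧ S.s₀ ab = b ∧ S.s₀ c = ac ∧ S.s₀ ac = c ∧
      S.s₀ bc = abc ∧ S.s₀ abc = bc := by simp [ha, hb, hc, hab, hac, hbc, habc]
  have B : S.s₁ u = b ∧ S.s₁ b = u ∧ S.s₁ a = ab ∧ S.s₁ ab = a ∧ S.s₁ c = bc ∧ S.s₁ bc = c ∧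
      S.s₁ ac = abc ∧ S.s₁ abc = ac := by simp [ha, hb, hc, hab, hac, hbc, habc]
  have C : S.s₂ u = c ∧ S.s₂ c = u ∧ S.s₂ a = ac ∧ S.s₂ ac = a ∧ S.s₂ b = bc ∧ S.s₂ bc = b ∧
      S.s₂ ab = abc ∧ S.s₂ abc = ab := by simp [ha, hb, hc, hab, hac, hbc, habc]
  clear ha hb hc hab hac hbc habc
  have U : ∀ {x y z : K}, IsIntegralUnit x → IsIntegralUnit y → IsIntegralUnit z →
    IsIntegralUnit (u * x * y * z) := fun h1 h2 h3 => ((hu.mul h1).mul h2).mul h3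
  obtain ⟨n₀, e₀⟩ := key (r := S.r₀) (v := u * b * c * bc) (a * ab * ac * abc)
    Nat.prime_two.prime.not_isSquare S.coe_r₀ (U ub uc ubc)
    (.inr ⟨by simp, by simp only [map_mul, A], by simp only [map_mul, A]⟩)
    (.inl ⟨by simp, by simp only [map_mul, B]; ring, by simp only [map_mul, B]; ring⟩)
    (.inl ⟨by simp, by simp only [map_mul, C]; ring, by simp only [map_mul, C]; ring⟩)
  obtain ⟨n₁, e₁⟩ := key (r := S.r₁) (v := u * a * c * ac) (b * ab * bc * abc)
    hp.prime.not_isSquare S.coe_r₁ (U ua uc uac)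
    (.inl ⟨by simp, by simp only [map_mul, A]; ring, by simp only [map_mul, A]; ring⟩)
    (.inr ⟨by simp, by simp only [map_mul, B], by simp only [map_mul, B]⟩)
    (.inl ⟨by simp, by simp only [map_mul, C]; ring, by simp only [map_mul, C]; ring⟩)
  obtain ⟨n₂, e₂⟩ := key (r := S.r₂) (v := u * a * b * ab) (c * ac * bc * abc)
    hq.prime.not_isSquare S.coe_r₂ (U ua ub uab)
    (.inl ⟨by simp, by simp only [map_mul, A]; ring, by simp only [map_mul, A]; ring⟩)
    (.inl ⟨by simp, by simp only [map_mul, B]; ring, by simp only [map_mul, B]; ring⟩)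
    (.inr ⟨by simp, by simp only [map_mul, C], by simp only [map_mul, C]⟩)
  obtain ⟨n₀₁, e₀₁⟩ := key (r := S.r₀ * S.r₁) (v := u * c * ab * abc) (a * b * ac * bc)
    (not_isSquare_prime_mul Nat.prime_two h2p) S.coe_r₀_mul_r₁ (U uc uab uabc)
    (.inr ⟨by simp, by simp only [map_mul, A]; ring, by simp only [map_mul, A]; ring⟩)
    (.inr ⟨by simp, by simp only [map_mul, B]; ring, by simp only [map_mul, B]; ring⟩)
    (.inl ⟨by simp, by simp only [map_mul, C]; ring, by simp only [map_mul, C]; ring⟩)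
  obtain ⟨n₀₂, e₀₂⟩ := key (r := S.r₀ * S.r₂) (v := u * b * ac * abc) (a * c * ab * bc)
    (not_isSquare_prime_mul Nat.prime_two h2q) S.swap.coe_r₀_mul_r₁ (U ub uac uabc)
    (.inr ⟨by simp, by simp only [map_mul, A]; ring, by simp only [map_mul, A]; ring⟩)
    (.inl ⟨by simp, by simp only [map_mul, B]; ring, by simp only [map_mul, B]; ring⟩)
    (.inr ⟨by simp, by simp only [map_mul, C]; ring, by simp only [map_mul, C]; ring⟩)
  obtain ⟨n₁₂, e₁₂⟩ := key (r := S.r₁ * S.r₂) (v := u * a * bc * abc) (b * c * ab * ac)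
    (not_isSquare_prime_mul hp hpq') S.coe_r₁_mul_r₂ (U ua ubc uabc)
    (.inl ⟨by simp, by simp only [map_mul, A]; ring, by simp only [map_mul, A]; ring⟩)
    (.inr ⟨by simp, by simp only [map_mul, B]; ring, by simp only [map_mul, B]; ring⟩)
    (.inr ⟨by simp, by simp only [map_mul, C]; ring, by simp only [map_mul, C]; ring⟩)
  obtain ⟨n₀₁₂, e₀₁₂⟩ := key (r := S.r₀ * S.r₁ * S.r₂) (v := u * ab * ac * bc) (a * b * c * abc)
    (mul_assoc 2 p q ▸ not_isSquare_prime_mul Nat.prime_two h2pq) S.coe_r₀_mul_r₁_mul_r₂ (U uab uac ubc)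
    (.inr ⟨by simp, by simp only [map_mul, A], by simp only [map_mul, A]⟩)
    (.inr ⟨by simp, by simp only [map_mul, B]; ring, by simp only [map_mul, B]; ring⟩)
    (.inr ⟨by simp, by simp only [map_mul, C]; ring, by simp only [map_mul, C]; ring⟩)
  -- the norm of `u` is a rational integral unit
  have hN : |((u * b * c * bc * (a * ab * ac * abc) : K) : ℝ)| = 1 := by
    obtain ⟨x, hx⟩ := S.exists_rat (u * b * c * bc * (a * ab * ac * abc))
      (by simp only [map_mul, A]; ring)
      (by simp only [map_mul, B]; ring)
      (by simp only [map_mul, C]; ring)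
    have hNu := (U ub uc ubc).mul (((ua.mul uab).mul uac).mul uabc)
    obtain ⟨k, hk⟩ := exists_int_of_isIntegral hNu.2 hx
    obtain ⟨l, hl⟩ := exists_int_of_isIntegral hNu.3 (a := x⁻¹) (by rw [hx]; push_cast; rfl)
    have hkl : k * l = 1 := by
      have : (k * l : K) = 1 := by rw [← hk, ← hl, mul_inv_cancel₀ hNu.1]
      exact_mod_cast this
    rw [hk]
    rcases Int.eq_one_or_neg_one_of_mul_eq_one hkl with rfl | rfl <;> simp
  refine ⟨n₀, n₁, n₂, n₀₁, n₀₂, n₁₂, n₀₁₂, ?_⟩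
  rw [← e₀, ← e₁, ← e₂, ← e₀₁, ← e₀₂, ← e₁₂, ← e₀₁₂]
  simp only [IntermediateField.coe_mul, abs_mul] at hN ⊢
  linear_combination -|(u : ℝ)| ^ 4 * ((|(u : ℝ)| * |(b : ℝ)| * |(c : ℝ)| * |(bc : ℝ)| *
    (|(a : ℝ)| * |(ab : ℝ)| * |(ac : ℝ)| * |(abc : ℝ)|)) ^ 2 + (|(u : ℝ)| * |(b : ℝ)| * |(c : ℝ)| *
    |(bc : ℝ)| * (|(a : ℝ)| * |(ab : ℝ)| * |(ac : ℝ)| * |(abc : ℝ)|)) + 1) * hN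

end FlipSystem

/-! ### Signs, and the quadratic units in the triquadratic field -/

/-- The nonzero real number `x` has the sign of `(-1) ^ k`. -/
def HasSign (k : ℤ) (x : ℝ) : Prop := 0 < (-1) ^ k * x

namespace HasSign

variable {k l : ℤ} {x y : ℝ}

theorem of_pos (h : 0 < x) : HasSign 0 x := by simpa [HasSign] using h

theorem of_neg (h : x < 0) : HasSign 1 x := by simpa [HasSign] using h

theorem mul (hx : HasSign k x) (hy : HasSign l y) : HasSign (k + l) (x * y) := by
  rw [HasSign, zpow_add₀ (by norm_num), mul_mul_mul_comm]
  exact mul_pos hx hy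

theorem zpow (hx : HasSign k x) (n : ℤ) : HasSign (k * n) (x ^ n) := by
  have := zpow_pos hx n
  rwa [mul_zpow, ← zpow_mul] at this

theorem even (hx : HasSign k x) (h : 0 < x) : Even k := by
  by_contra hk
  rw [HasSign, (Int.not_even_iff_odd.mp hk).neg_one_zpow] at hx
  linarith

end HasSign


/-- `x ↦ σ x`, as a map to the real numbers. -/
noncomputable def realConj (σ : K ≃ₐ[ℚ] K) : K →*₀ ℝ :=
  ((algebraMap K ℝ).comp (σ : K →+* K)).toMonoidWithZeroHom

theorem realConj_apply (σ : K ≃ₐ[ℚ] K) (x : K) : realConj σ x = (σ x : ℝ) := rfl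

/-- The norm `x · σ x · τ x · σ τ x` for the Klein four-group generated by `σ` and `τ`, as a real
number. -/
noncomputable def biNorm (σ τ : K ≃ₐ[ℚ] K) : K →*₀ ℝ where
  toFun x := ((x * σ x * τ x * σ (τ x) : K) : ℝ)
  map_zero' := by simp
  map_one' := by simp
  map_mul' x y := by simp only [map_mul]; push_cast; ring

theorem biNorm_apply (σ τ : K ≃ₐ[ℚ] K) (x : K) :
    biNorm σ τ x = ((x * σ x * τ x * σ (τ x) : K) : ℝ) := rfl

theorem coe_sq_pos {x : K} (hx : x ≠ 0) : 0 < ((x ^ 2 : K) : ℝ) := by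
  have : (x : ℝ) ≠ 0 := fun h => hx (Subtype.ext h)
  push_cast
  positivity

/-- If `τ` divides `w²` by `ζ²`, then the norm of `w` has the sign of `ζ · σ ζ`. -/
theorem hasSign_biNorm {σ τ : K ≃ₐ[ℚ] K} {w ζ : K} (hw : w ≠ 0) (hζ : ζ ≠ 0)
    (h : τ (w ^ 2) * ζ ^ 2 = w ^ 2) {k : ℤ} (hk : HasSign k ((ζ * σ ζ : K) : ℝ)) :
    HasSign k (biNorm σ τ w) := by
  have hσζ : σ ζ ≠ 0 := (map_ne_zero σ).mpr hζ
  have hσw : σ w ≠ 0 := (map_ne_zero σ).mpr hw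
  have h1 : (τ w) ^ 2 = (w / ζ) ^ 2 := by
    rw [div_pow, eq_div_iff (pow_ne_zero 2 hζ), ← map_pow, h]
  have h2 : w * σ w * τ w * σ (τ w) = (ζ * σ ζ) * (w * σ w / (ζ * σ ζ)) ^ 2 := by
    rcases sq_eq_sq_iff_eq_or_eq_neg.mp h1 with h | h <;> simp only [h, map_div₀, map_neg] <;>
      field_simp
  have h3 := coe_sq_pos (div_ne_zero (mul_ne_zero hw hσw) (mul_ne_zero hζ hσζ))
  rw [biNorm_apply, h2, IntermediateField.coe_mul]
  simpa using hk.mul (.of_pos h3)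

/-- Units of the seven quadratic subfields of a real field `K` with a flip system, and square roots
of products of them that lie in `K`. Here `(-1) ^ κ₁` and `(-1) ^ κ₂` are the norms of
`ε_{2p}` and `ε_{2q}`. The index of `eᵢ`, `eᵢⱼ` and `e₀₁₂` tells the roots among `r₀ = √2`,
`r₁ = √p`, `r₂ = √q` whose product generates the quadratic field. -/
structure UnitData (S : FlipSystem p q K) (κ₁ κ₂ : ℕ) where
  (e₀ e₁ e₂ e₀₁ e₀₂ e₁₂ e₀₁₂ : K)
  coe_e₀ : (e₀ : ℝ) = ε 2
  coe_e₁ : (e₁ : ℝ) = ε p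
  coe_e₂ : (e₂ : ℝ) = ε q
  coe_e₀₁ : (e₀₁ : ℝ) = ε (2 * p)
  coe_e₀₂ : (e₀₂ : ℝ) = ε (2 * q)
  coe_e₁₂ : (e₁₂ : ℝ) = ε (p * q)
  coe_e₀₁₂ : (e₀₁₂ : ℝ) = ε (2 * p * q)
  one_lt : 1 < ε 2 ∧ 1 < ε p ∧ 1 < ε q ∧ 1 < ε (2 * p) ∧ 1 < ε (2 * q) ∧ 1 < ε (p * q) ∧
    1 < ε (2 * p * q)
  act₀ : S.s₀ e₀ = -e₀⁻¹ ∧ S.s₀ e₁ = e₁ ∧ S.s₀ e₂ = e₂ ∧ S.s₀ e₀₁ = (-1) ^ κ₁ * e₀₁⁻¹ ∧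
    S.s₀ e₀₂ = (-1) ^ κ₂ * e₀₂⁻¹ ∧ S.s₀ e₁₂ = e₁₂ ∧ S.s₀ e₀₁₂ = -e₀₁₂⁻¹
  act₁ : S.s₁ e₀ = e₀ ∧ S.s₁ e₁ = -e₁⁻¹ ∧ S.s₁ e₂ = e₂ ∧ S.s₁ e₀₁ = (-1) ^ κ₁ * e₀₁⁻¹ ∧
    S.s₁ e₀₂ = e₀₂ ∧ S.s₁ e₁₂ = -e₁₂⁻¹ ∧ S.s₁ e₀₁₂ = -e₀₁₂⁻¹
  act₂ : S.s₂ e₀ = e₀ ∧ S.s₂ e₁ = e₁ ∧ S.s₂ e₂ = -e₂⁻¹ ∧ S.s₂ e₀₁ = e₀₁ ∧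
    S.s₂ e₀₂ = (-1) ^ κ₂ * e₀₂⁻¹ ∧ S.s₂ e₁₂ = -e₁₂⁻¹ ∧ S.s₂ e₀₁₂ = -e₀₁₂⁻¹
  (w₁ w₂ w₃ w₄ : K)
  w_pos : 0 < (w₁ : ℝ) ∧ 0 < (w₂ : ℝ) ∧ 0 < (w₃ : ℝ) ∧ 0 < (w₄ : ℝ)
  w₁_sq : w₁ ^ 2 = (e₀ * e₁) ^ κ₁ * e₀₁
  w₂_sq : w₂ ^ 2 = (e₀ * e₂) ^ κ₂ * e₀₂
  w₃_sq : w₃ ^ 2 = e₀ * e₁₂ * e₀₁₂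
  w₄_sq : w₄ ^ 2 = e₁ * e₂ * e₁₂

theorem ε_mem_of_sqrt_mem {d : ℕ} (h : √(d : ℝ) ∈ K) : ε d ∈ K := by
  have : quadField d ≤ K := by
    rw [quadField, IntermediateField.adjoin_simple_le_iff]
    exact h
  exact this (ε_mem_quadField d)

theorem nonempty_unitData (S : FlipSystem p q K) (hp : p.Prime) (hq : q.Prime) (hp2 : p ≠ 2)
    (hq2 : q ≠ 2) (hpq : p ≠ q) (hp4 : p ≡ 1 [MOD 4]) (hq4 : q ≡ 1 [MOD 4])
    (h₁₂ : normFundUnit (p * q) = -1) (h₀₁₂ : normFundUnit (2 * p * q) = -1) {κ₁ κ₂ : ℕ}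
    (hκ₁ : κ₁ ≤ 1) (hκ₂ : κ₂ ≤ 1) (h₀₁ : normFundUnit (2 * p) = (-1) ^ κ₁)
    (h₀₂ : normFundUnit (2 * q) = (-1) ^ κ₂) : Nonempty (UnitData S κ₁ κ₂) := by
  have h2p : ¬ 2 ∣ p := fun h => hp2 ((Nat.prime_dvd_prime_iff_eq Nat.prime_two hp).mp h).symm
  have h2q : ¬ 2 ∣ q := fun h => hq2 ((Nat.prime_dvd_prime_iff_eq Nat.prime_two hq).mp h).symm
  have hpq' : ¬ p ∣ q := fun h => hpq ((Nat.prime_dvd_prime_iff_eq hp hq).mp h)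
  have h2pq : ¬ 2 ∣ p * q := fun h => (Nat.prime_two.dvd_mul.mp h).elim h2p h2q
  have ns₀ : ¬ IsSquare 2 := Nat.prime_two.prime.not_isSquare
  have ns₁ : ¬ IsSquare p := hp.prime.not_isSquare
  have ns₂ : ¬ IsSquare q := hq.prime.not_isSquare
  have ns₀₁ : ¬ IsSquare (2 * p) := not_isSquare_prime_mul Nat.prime_two h2p
  have ns₀₂ : ¬ IsSquare (2 * q) := not_isSquare_prime_mul Nat.prime_two h2q
  have ns₁₂ : ¬ IsSquare (p * q) := not_isSquare_prime_mul hp hpq'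
  have ns₀₁₂ : ¬ IsSquare (2 * p * q) :=
    mul_assoc 2 p q ▸ not_isSquare_prime_mul Nat.prime_two h2pq
  have N₀ : normFundUnit 2 = -1 := normFundUnit_eq_neg_one ns₀ (x := 1) (y := 1) (by norm_num)
  have N₁ : normFundUnit p = -1 := by
    obtain ⟨x, y, h⟩ := exists_negative_pell hp hp4
    exact normFundUnit_eq_neg_one ns₁ h
  have N₂ : normFundUnit q = -1 := by
    obtain ⟨x, y, h⟩ := exists_negative_pell hq hq4
    exact normFundUnit_eq_neg_one ns₂ h
  have key : ∀ {d : ℕ} {n : ℚ}, ¬ IsSquare d → normFundUnit d = n → ∀ r : K, (r : ℝ) = √d →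
      ∃ e : K, (e : ℝ) = ε d ∧ IsIntegralUnit e ∧ ∀ σ : K ≃ₐ[ℚ] K, (σ r = r → σ e = e) ∧
        (σ r = -r → σ e = n * e⁻¹) := by
    rintro d n hd rfl r hr
    have h1 := one_lt_ε hd
    refine ⟨⟨ε d, ε_mem_of_sqrt_mem (hr ▸ r.2)⟩, rfl, ?_, fun σ => conj_ε hd σ hr rfl⟩
    exact .of_coe (by linarith) (isIntegral_ε d) (isIntegral_ε_inv d)
  obtain ⟨e₀, c₀, u₀, a₀⟩ := key ns₀ N₀ S.r₀ S.coe_r₀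
  obtain ⟨e₁, c₁, u₁, a₁⟩ := key ns₁ N₁ S.r₁ S.coe_r₁
  obtain ⟨e₂, c₂, u₂, a₂⟩ := key ns₂ N₂ S.r₂ S.coe_r₂
  obtain ⟨e₀₁, c₀₁, u₀₁, a₀₁⟩ := key ns₀₁ h₀₁ (S.r₀ * S.r₁) S.coe_r₀_mul_r₁
  obtain ⟨e₀₂, c₀₂, u₀₂, a₀₂⟩ := key ns₀₂ h₀₂ (S.r₀ * S.r₂) S.swap.coe_r₀_mul_r₁
  obtain ⟨e₁₂, c₁₂, u₁₂, a₁₂⟩ := key ns₁₂ h₁₂ (S.r₁ * S.r₂) S.coe_r₁_mul_r₂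
  obtain ⟨e₀₁₂, c₀₁₂, u₀₁₂, a₀₁₂⟩ := key ns₀₁₂ h₀₁₂ (S.r₀ * S.r₁ * S.r₂) S.coe_r₀_mul_r₁_mul_r₂
  have g₀ := c₀ ▸ one_lt_ε ns₀
  have g₁ := c₁ ▸ one_lt_ε ns₁
  have g₂ := c₂ ▸ one_lt_ε ns₂
  have g₀₁ := c₀₁ ▸ one_lt_ε ns₀₁
  have g₀₂ := c₀₂ ▸ one_lt_ε ns₀₂
  have g₁₂ := c₁₂ ▸ one_lt_ε ns₁₂
  have g₀₁₂ := c₀₁₂ ▸ one_lt_ε ns₀₁₂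
  have A₀ : S.s₀ e₀ = -e₀⁻¹ ∧ S.s₀ e₁ = e₁ ∧ S.s₀ e₂ = e₂ ∧ S.s₀ e₀₁ = (-1) ^ κ₁ * e₀₁⁻¹ ∧
      S.s₀ e₀₂ = (-1) ^ κ₂ * e₀₂⁻¹ ∧ S.s₀ e₁₂ = e₁₂ ∧ S.s₀ e₀₁₂ = -e₀₁₂⁻¹ :=
    ⟨by simpa using (a₀ S.s₀).2, by simpa using (a₁ S.s₀).1, by simpa using (a₂ S.s₀).1,
      by simpa using (a₀₁ S.s₀).2, by simpa using (a₀₂ S.s₀).2, by simpa using (a₁₂ S.s₀).1,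
      by simpa using (a₀₁₂ S.s₀).2⟩
  have A₁ : S.s₁ e₀ = e₀ ∧ S.s₁ e₁ = -e₁⁻¹ ∧ S.s₁ e₂ = e₂ ∧ S.s₁ e₀₁ = (-1) ^ κ₁ * e₀₁⁻¹ ∧
      S.s₁ e₀₂ = e₀₂ ∧ S.s₁ e₁₂ = -e₁₂⁻¹ ∧ S.s₁ e₀₁₂ = -e₀₁₂⁻¹ :=
    ⟨by simpa using (a₀ S.s₁).1, by simpa using (a₁ S.s₁).2, by simpa using (a₂ S.s₁).1,
      by simpa using (a₀₁ S.s₁).2, by simpa using (a₀₂ S.s₁).1, by simpa using (a₁₂ S.s₁).2,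
      by simpa using (a₀₁₂ S.s₁).2⟩
  have A₂ : S.s₂ e₀ = e₀ ∧ S.s₂ e₁ = e₁ ∧ S.s₂ e₂ = -e₂⁻¹ ∧ S.s₂ e₀₁ = e₀₁ ∧
      S.s₂ e₀₂ = (-1) ^ κ₂ * e₀₂⁻¹ ∧ S.s₂ e₁₂ = -e₁₂⁻¹ ∧ S.s₂ e₀₁₂ = -e₀₁₂⁻¹ :=
    ⟨by simpa using (a₀ S.s₂).1, by simpa using (a₁ S.s₂).1, by simpa using (a₂ S.s₂).2,
      by simpa using (a₀₁ S.s₂).1, by simpa using (a₀₂ S.s₂).2, by simpa using (a₁₂ S.s₂).2,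
      by simpa using (a₀₁₂ S.s₂).2⟩
  obtain ⟨w₁, p₁, q₁⟩ : ∃ w : K, 0 < (w : ℝ) ∧ w ^ 2 = (e₀ * e₁) ^ κ₁ * e₀₁ := by
    interval_cases κ₁
    · simpa using S.exists_sq_eq_of_norm_one hp hq u₀₁ g₀₁ (by simp [A₀]) (by simp [A₁])
        (by simp [A₂])
    · simpa using S.exists_sq_eq_mul_mul hp hq u₀ u₁ u₀₁ g₀ g₁ g₀₁ (by simp [FlipSystem.FlipsEven, A₀])
        (by simp [FlipSystem.FlipsEven, A₁]) (by simp [FlipSystem.FlipsEven, A₂])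
  obtain ⟨w₂, p₂, q₂⟩ : ∃ w : K, 0 < (w : ℝ) ∧ w ^ 2 = (e₀ * e₂) ^ κ₂ * e₀₂ := by
    interval_cases κ₂
    · simpa using S.exists_sq_eq_of_norm_one hp hq u₀₂ g₀₂ (by simp [A₀]) (by simp [A₁])
        (by simp [A₂])
    · simpa using S.exists_sq_eq_mul_mul hp hq u₀ u₂ u₀₂ g₀ g₂ g₀₂ (by simp [FlipSystem.FlipsEven, A₀])
        (by simp [FlipSystem.FlipsEven, A₁]) (by simp [FlipSystem.FlipsEven, A₂])
  obtain ⟨w₃, p₃, q₃⟩ := S.exists_sq_eq_mul_mul hp hq u₀ u₁₂ u₀₁₂ g₀ g₁₂ g₀₁₂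
    (by simp [FlipSystem.FlipsEven, A₀]) (by simp [FlipSystem.FlipsEven, A₁])
    (by simp [FlipSystem.FlipsEven, A₂])
  obtain ⟨w₄, p₄, q₄⟩ := S.exists_sq_eq_mul_mul hp hq u₁ u₂ u₁₂ g₁ g₂ g₁₂
    (by simp [FlipSystem.FlipsEven, A₀]) (by simp [FlipSystem.FlipsEven, A₁])
    (by simp [FlipSystem.FlipsEven, A₂])
  exact ⟨⟨e₀, e₁, e₂, e₀₁, e₀₂, e₁₂, e₀₁₂, c₀, c₁, c₂, c₀₁, c₀₂, c₁₂, c₀₁₂,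
    ⟨one_lt_ε ns₀, one_lt_ε ns₁, one_lt_ε ns₂, one_lt_ε ns₀₁, one_lt_ε ns₀₂, one_lt_ε ns₁₂,
      one_lt_ε ns₀₁₂⟩, A₀, A₁, A₂, w₁, w₂, w₃, w₄, ⟨p₁, p₂, p₃, p₄⟩, q₁, q₂, q₃, q₄⟩⟩

namespace UnitData

variable {S : FlipSystem p q K} {κ₁ κ₂ : ℕ}

/-- The roles of `p` and `q` exchanged. -/
noncomputable def swap (E : UnitData S κ₁ κ₂) : UnitData S.swap κ₂ κ₁ where
  e₀ := E.e₀
  e₁ := E.e₂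
  e₂ := E.e₁
  e₀₁ := E.e₀₂
  e₀₂ := E.e₀₁
  e₁₂ := E.e₁₂
  e₀₁₂ := E.e₀₁₂
  coe_e₀ := E.coe_e₀
  coe_e₁ := E.coe_e₂
  coe_e₂ := E.coe_e₁
  coe_e₀₁ := E.coe_e₀₂
  coe_e₀₂ := E.coe_e₀₁
  coe_e₁₂ := by rw [mul_comm]; exact E.coe_e₁₂
  coe_e₀₁₂ := by rw [mul_right_comm]; exact E.coe_e₀₁₂
  one_lt := by
    rw [mul_comm q p, mul_right_comm 2 q p]
    have := E.one_lt
    tauto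
  act₀ := by have := E.act₀; simp only [FlipSystem.swap]; tauto
  act₁ := by have := E.act₂; simp only [FlipSystem.swap]; tauto
  act₂ := by have := E.act₁; simp only [FlipSystem.swap]; tauto
  w₁ := E.w₂
  w₂ := E.w₁
  w₃ := E.w₃
  w₄ := E.w₄
  w_pos := by have := E.w_pos; tauto
  w₁_sq := E.w₂_sq
  w₂_sq := E.w₁_sq
  w₃_sq := E.w₃_sq
  w₄_sq := by rw [E.w₄_sq]; ring

end UnitData

/-! ### Squares of units as power products -/

variable {S : FlipSystem p q K} {κ₁ κ₂ : ℕ}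

namespace UnitData

theorem gt_one (E : UnitData S κ₁ κ₂) : 1 < (E.e₀ : ℝ) ∧ 1 < (E.e₁ : ℝ) ∧ 1 < (E.e₂ : ℝ) ∧
    1 < (E.e₀₁ : ℝ) ∧ 1 < (E.e₀₂ : ℝ) ∧ 1 < (E.e₁₂ : ℝ) ∧ 1 < (E.e₀₁₂ : ℝ) := by
  rw [E.coe_e₀, E.coe_e₁, E.coe_e₂, E.coe_e₀₁, E.coe_e₀₂, E.coe_e₁₂, E.coe_e₀₁₂]
  exact E.one_lt

theorem ne_zero_of_coe_pos {x : K} (h : 0 < (x : ℝ)) : x ≠ 0 := by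
  rintro rfl
  simp at h

theorem ne_zero (E : UnitData S κ₁ κ₂) : E.e₀ ≠ 0 ∧ E.e₁ ≠ 0 ∧ E.e₂ ≠ 0 ∧ E.e₀₁ ≠ 0 ∧
    E.e₀₂ ≠ 0 ∧ E.e₁₂ ≠ 0 ∧ E.e₀₁₂ ≠ 0 ∧ E.w₁ ≠ 0 ∧ E.w₂ ≠ 0 ∧ E.w₃ ≠ 0 ∧ E.w₄ ≠ 0 := by
  have h := E.gt_one
  have h' := E.w_pos
  refine ⟨?_, ?_, ?_, ?_, ?_, ?_, ?_, ?_, ?_, ?_, ?_⟩ <;> apply ne_zero_of_coe_pos <;> linarith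

/-- A power product of `e₀, e₁, e₂, w₁, w₂, w₃, w₄`. -/
noncomputable def prod (E : UnitData S κ₁ κ₂) (a b c d₁ d₂ d₃ d₄ : ℤ) : K :=
  E.e₀ ^ a * E.e₁ ^ b * E.e₂ ^ c * E.w₁ ^ d₁ * E.w₂ ^ d₂ * E.w₃ ^ d₃ * E.w₄ ^ d₄

theorem prod_add (E : UnitData S κ₁ κ₂) (a b c d₁ d₂ d₃ d₄ a' b' c' d₁' d₂' d₃' d₄' : ℤ) :
    E.prod (a + a') (b + b') (c + c') (d₁ + d₁') (d₂ + d₂') (d₃ + d₃') (d₄ + d₄') =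
      E.prod a b c d₁ d₂ d₃ d₄ * E.prod a' b' c' d₁' d₂' d₃' d₄' := by
  obtain ⟨h0, h1, h2, -, -, -, -, h3, h4, h5, h6⟩ := E.ne_zero
  simp only [prod, zpow_add₀ h0, zpow_add₀ h1, zpow_add₀ h2, zpow_add₀ h3, zpow_add₀ h4,
    zpow_add₀ h5, zpow_add₀ h6]
  ring

theorem prod_pos (E : UnitData S κ₁ κ₂) (a b c d₁ d₂ d₃ d₄ : ℤ) :
    0 < (E.prod a b c d₁ d₂ d₃ d₄ : ℝ) := by
  have h := E.gt_one
  obtain ⟨h0, h1, h2, -⟩ := E.gt_one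
  obtain ⟨h3, h4, h5, h6⟩ := E.w_pos
  have hz : ∀ {x : K}, 0 < (x : ℝ) → ∀ n : ℤ, 0 < ((x ^ n : K) : ℝ) := fun {x} h n => by
    rw [show ((x ^ n : K) : ℝ) = (x : ℝ) ^ n from map_zpow₀ (algebraMap K ℝ) x n]
    exact zpow_pos h n
  have := mul_pos (mul_pos (mul_pos (mul_pos (mul_pos (mul_pos (hz (one_pos.trans h0) a)
    (hz (one_pos.trans h1) b)) (hz (one_pos.trans h2) c)) (hz h3 d₁)) (hz h4 d₂)) (hz h5 d₃))
    (hz h6 d₄)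
  simpa [prod] using this

theorem log_coe_prod (E : UnitData S κ₁ κ₂) (a b c d₁ d₂ d₃ d₄ : ℤ) :
    Real.log (E.prod a b c d₁ d₂ d₃ d₄ : ℝ) = a * Real.log E.e₀ + b * Real.log E.e₁ +
      c * Real.log E.e₂ + d₁ * Real.log E.w₁ + d₂ * Real.log E.w₂ + d₃ * Real.log E.w₃ +
      d₄ * Real.log E.w₄ := by
  have hz : ∀ (x : K) (n : ℤ), ((x ^ n : K) : ℝ) = (x : ℝ) ^ n := fun x n =>
    map_zpow₀ (algebraMap K ℝ) x n
  have h : ∀ {x : K}, x ≠ 0 → ∀ n : ℤ, (x : ℝ) ^ n ≠ 0 := fun hx n =>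
    zpow_ne_zero n fun h0 => hx (Subtype.ext h0)
  obtain ⟨h0, h1, h2, -, -, -, -, h3, h4, h5, h6⟩ := E.ne_zero
  simp only [prod, IntermediateField.coe_mul, hz]
  rw [Real.log_mul, Real.log_mul, Real.log_mul, Real.log_mul, Real.log_mul, Real.log_mul,
    Real.log_zpow, Real.log_zpow, Real.log_zpow, Real.log_zpow, Real.log_zpow, Real.log_zpow,
    Real.log_zpow]
  all_goals simp [h, h0, h1, h2, h3, h4, h5, h6]

theorem hasSign_realConj {σ : K ≃ₐ[ℚ] K} {x : K} (hx : 1 < (x : ℝ)) {κ : ℕ}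
    (h : σ x = (-1) ^ κ * x⁻¹) : HasSign κ (realConj σ x) := by
  rw [realConj_apply, h, HasSign]
  push_cast
  rw [zpow_natCast, ← mul_assoc, ← mul_pow]
  norm_num
  linarith

theorem hasSign_realConj_of_fixed {σ : K ≃ₐ[ℚ] K} {x : K} (hx : 1 < (x : ℝ))
    (h : σ x = x) : HasSign 0 (realConj σ x) := by
  rw [realConj_apply, h]
  exact .of_pos (by linarith)

theorem hasSign_realConj_of_neg {σ : K ≃ₐ[ℚ] K} {x : K} (hx : 1 < (x : ℝ))
    (h : σ x = -x⁻¹) : HasSign 1 (realConj σ x) :=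
  hasSign_realConj (κ := 1) hx (by rw [h]; ring)

/-- The square of a positive unit of `K` is a power product of `e₀, e₁, e₂, w₁, w₂, w₃, w₄`, because
its fourth power is a totally positive power product of quadratic units. -/
theorem exists_sq_eq_prod (E : UnitData S κ₁ κ₂) (hp : p.Prime) (hq : q.Prime) (hp2 : p ≠ 2)
    (hq2 : q ≠ 2) (hpq : p ≠ q) {u : K} (hu : IsIntegralUnit u) (hpos : 0 < (u : ℝ)) :
    ∃ a b c d₁ d₂ d₃ d₄ : ℤ, u ^ 2 = E.prod a b c d₁ d₂ d₃ d₄ := by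
  obtain ⟨n₀, n₁, n₂, n₀₁, n₀₂, n₁₂, n₀₁₂, hn⟩ := S.exists_pow_four_eq hp hq hp2 hq2 hpq hu
  rw [abs_of_pos hpos, ← E.coe_e₀, ← E.coe_e₁, ← E.coe_e₂, ← E.coe_e₀₁, ← E.coe_e₀₂, ← E.coe_e₁₂,
    ← E.coe_e₀₁₂] at hn
  obtain ⟨g0, g1, g2, g01, g02, g12, g012⟩ := E.gt_one
  have hn' : u ^ 4 = E.e₀ ^ n₀ * E.e₁ ^ n₁ * E.e₂ ^ n₂ * E.e₀₁ ^ n₀₁ * E.e₀₂ ^ n₀₂ *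
      E.e₁₂ ^ n₁₂ * E.e₀₁₂ ^ n₀₁₂ := by
    apply (algebraMap K ℝ).injective
    simp only [map_pow, map_mul, map_zpow₀]
    exact hn
  have hpos4 : ∀ σ : K ≃ₐ[ℚ] K, 0 < realConj σ (u ^ 4) := fun σ => by
    rw [realConj_apply, show u ^ 4 = (u ^ 2) ^ 2 by ring, map_pow]
    exact coe_sq_pos ((map_ne_zero σ).mpr (pow_ne_zero 2 hu.1))
  have sign : ∀ (σ : K ≃ₐ[ℚ] K) {k₀ k₁ k₂ k₀₁ k₀₂ k₁₂ k₀₁₂ : ℤ}, HasSign k₀ (realConj σ E.e₀) →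
      HasSign k₁ (realConj σ E.e₁) → HasSign k₂ (realConj σ E.e₂) →
      HasSign k₀₁ (realConj σ E.e₀₁) → HasSign k₀₂ (realConj σ E.e₀₂) →
      HasSign k₁₂ (realConj σ E.e₁₂) → HasSign k₀₁₂ (realConj σ E.e₀₁₂) →
      Even (k₀ * n₀ + k₁ * n₁ + k₂ * n₂ + k₀₁ * n₀₁ + k₀₂ * n₀₂ + k₁₂ * n₁₂ + k₀₁₂ * n₀₁₂) := by
    intro σ k₀ k₁ k₂ k₀₁ k₀₂ k₁₂ k₀₁₂ h0 h1 h2 h01 h02 h12 h012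
    refine HasSign.even ?_ (hpos4 σ)
    rw [hn']
    simp only [map_mul, map_zpow₀]
    exact ((((((h0.zpow _).mul (h1.zpow _)).mul (h2.zpow _)).mul (h01.zpow _)).mul
      (h02.zpow _)).mul (h12.zpow _)).mul (h012.zpow _)
  obtain ⟨a0, a1, a2, a01, a02, a12, a012⟩ := E.act₀
  obtain ⟨b0, b1, b2, b01, b02, b12, b012⟩ := E.act₁
  obtain ⟨c0, c1, c2, c01, c02, c12, c012⟩ := E.act₂
  obtain ⟨a, ha⟩ := sign S.s₀ (hasSign_realConj_of_neg g0 a0) (hasSign_realConj_of_fixed g1 a1)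
    (hasSign_realConj_of_fixed g2 a2) (hasSign_realConj g01 a01) (hasSign_realConj g02 a02)
    (hasSign_realConj_of_fixed g12 a12) (hasSign_realConj_of_neg g012 a012)
  obtain ⟨b, hb⟩ := sign S.s₁ (hasSign_realConj_of_fixed g0 b0) (hasSign_realConj_of_neg g1 b1)
    (hasSign_realConj_of_fixed g2 b2) (hasSign_realConj g01 b01) (hasSign_realConj_of_fixed g02 b02)
    (hasSign_realConj_of_neg g12 b12) (hasSign_realConj_of_neg g012 b012)
  obtain ⟨c, hc⟩ := sign S.s₂ (hasSign_realConj_of_fixed g0 c0) (hasSign_realConj_of_fixed g1 c1)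
    (hasSign_realConj_of_neg g2 c2) (hasSign_realConj_of_fixed g01 c01) (hasSign_realConj g02 c02)
    (hasSign_realConj_of_neg g12 c12) (hasSign_realConj_of_neg g012 c012)
  refine ⟨a - κ₁ * n₀₁ - κ₂ * n₀₂ - n₀₁₂, b - κ₁ * n₀₁ - n₁₂, c - κ₂ * n₀₂ - n₁₂, n₀₁, n₀₂, n₀₁₂,
    n₁₂ - n₀₁₂, ?_⟩
  have hlog : Real.log ((u ^ 2 : K) : ℝ) = Real.log (E.prod (a - κ₁ * n₀₁ - κ₂ * n₀₂ - n₀₁₂)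
      (b - κ₁ * n₀₁ - n₁₂) (c - κ₂ * n₀₂ - n₁₂) n₀₁ n₀₂ n₀₁₂ (n₁₂ - n₀₁₂) : ℝ) := by
    rw [log_coe_prod]
    have p0 := one_pos.trans g0
    have p1 := one_pos.trans g1
    have p2 := one_pos.trans g2
    have p01 := one_pos.trans g01
    have p02 := one_pos.trans g02
    have p12 := one_pos.trans g12
    have p012 := one_pos.trans g012
    have l := congrArg Real.log hn
    rw [Real.log_mul, Real.log_mul, Real.log_mul, Real.log_mul, Real.log_mul, Real.log_mul,
      Real.log_zpow, Real.log_zpow, Real.log_zpow, Real.log_zpow, Real.log_zpow, Real.log_zpow,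
      Real.log_zpow, Real.log_pow] at l
    rotate_left
    iterate 12 positivity
    have l1 := congrArg (fun x : K => Real.log (x : ℝ)) E.w₁_sq
    have l2 := congrArg (fun x : K => Real.log (x : ℝ)) E.w₂_sq
    have l3 := congrArg (fun x : K => Real.log (x : ℝ)) E.w₃_sq
    have l4 := congrArg (fun x : K => Real.log (x : ℝ)) E.w₄_sq
    push_cast at l1 l2 l3 l4 l ⊢
    rw [Real.log_pow, Real.log_mul (by positivity) (by positivity), Real.log_pow,
      Real.log_mul (by positivity) (by positivity)] at l1 l2
    rw [Real.log_pow, Real.log_mul (by positivity) (by positivity),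
      Real.log_mul (by positivity) (by positivity)] at l3 l4
    rw [Real.log_pow]
    push_cast at l1 l2 l3 l4 ⊢
    have ha' : (n₀ + κ₁ * n₀₁ + κ₂ * n₀₂ + n₀₁₂ : ℝ) = a + a := by
      rw [← Int.cast_add, ← ha]; push_cast; ring
    have hb' : (n₁ + κ₁ * n₀₁ + n₁₂ + n₀₁₂ : ℝ) = b + b := by
      rw [← Int.cast_add, ← hb]; push_cast; ring
    have hc' : (n₂ + κ₂ * n₀₂ + n₁₂ + n₀₁₂ : ℝ) = c + c := by
      rw [← Int.cast_add, ← hc]; push_cast; ring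
    linear_combination (1 / 2) * l + (1 / 2) * Real.log E.e₀ * ha' + (1 / 2) * Real.log E.e₁ * hb' +
      (1 / 2) * Real.log E.e₂ * hc' - (n₀₁ / 2) * l1 - (n₀₂ / 2) * l2 - (n₀₁₂ / 2) * l3 -
      ((n₁₂ - n₀₁₂) / 2) * l4
  exact Subtype.ext (Real.log_injOn_pos (coe_sq_pos hu.1) (E.prod_pos _ _ _ _ _ _ _) hlog)

end UnitData

/-! ### Which power products are squares -/

theorem hasSign_biNorm_of_fixed_sq {σ τ : K ≃ₐ[ℚ] K} {w : K} (hw : w ≠ 0) (h : τ (w ^ 2) = w ^ 2) :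
    HasSign 0 (biNorm σ τ w) :=
  hasSign_biNorm (ζ := 1) hw one_ne_zero (by rw [h]; ring) (.of_pos (by simp))

theorem hasSign_biNorm_of_neg_inv {σ τ : K ≃ₐ[ℚ] K} {w : K} (hw : w ≠ 0) (h : τ w = -w⁻¹) :
    HasSign 0 (biNorm σ τ w) := by
  refine hasSign_biNorm (ζ := w ^ 2) hw (pow_ne_zero 2 hw) (by rw [map_pow, h]; field_simp)
    (.of_pos ?_)
  rw [map_pow, ← mul_pow]
  exact coe_sq_pos (mul_ne_zero hw ((map_ne_zero σ).mpr hw))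

/-- If the square of `x` times its conjugate under an involution `τ` is `± y²`, then `y` is fixed
by `τ`, because `x · τ x` is and `-1` is not a square. -/
theorem fixed_of_norm_pow_four {τ : K ≃ₐ[ℚ] K} (hτ : ∀ x, τ (τ x) = x) {x y : K} (hy : y ≠ 0)
    (h : x ^ 4 * τ (x ^ 4) = y ^ 4) : τ y = y := by
  have h1 : ((x * τ x) ^ 2) ^ 2 = (y ^ 2) ^ 2 := by
    rw [map_pow] at h
    linear_combination h
  have hfix : τ (x * τ x) = x * τ x := by rw [map_mul, hτ, mul_comm]
  rcases sq_eq_sq_iff_eq_or_eq_neg.mp h1 with h2 | h2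
  · rcases sq_eq_sq_iff_eq_or_eq_neg.mp h2 with h3 | h3
    · rw [← h3, hfix]
    · rw [← neg_eq_iff_eq_neg.mpr h3, map_neg, hfix]
  · have h3 := coe_sq_pos hy
    have h4 : (((x * τ x) ^ 2 : K) : ℝ) = -((y ^ 2 : K) : ℝ) := by rw [h2]; rfl
    have h5 : 0 ≤ (((x * τ x) ^ 2 : K) : ℝ) := by push_cast; positivity
    linarith

theorem sq_mul_map_zpow_of_neg_inv {τ : K ≃ₐ[ℚ] K} {e : K} (he : e ≠ 0) (h : τ e = -e⁻¹) (n : ℤ) :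
    (e ^ n * τ (e ^ n)) ^ 2 = 1 := by
  rw [map_zpow₀, h, ← mul_zpow, mul_neg, mul_inv_cancel₀ he, ← zpow_natCast, ← zpow_mul, mul_comm,
    zpow_mul]
  norm_num

theorem flip_mul_sq {x y z : K} (hy : y ≠ 0) (hz : z ≠ 0) (k : ℕ) :
    (x * -y⁻¹) ^ k * ((-1) ^ k * z⁻¹) * (y ^ k * z) ^ 2 = (x * y) ^ k * z := by
  have h1 : x * y = x * -y⁻¹ * -1 * y ^ 2 := by field_simp
  have h2 : z = z⁻¹ * z ^ 2 := by field_simp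
  calc _ = (x * -y⁻¹ * -1 * y ^ 2) ^ k * (z⁻¹ * z ^ 2) := by simp only [mul_pow]; ring
    _ = _ := by rw [← h1, ← h2]

namespace UnitData

theorem even_of_sq_eq_prod_aux (E : UnitData S κ₁ κ₂) {x : K} (hx : x ≠ 0)
    {a b c d₁ d₂ d₃ d₄ : ℤ} (h : x ^ 2 = E.prod a b c d₁ d₂ d₃ d₄) :
    Even (κ₁ * d₁ + d₃) ∧ Even d₄ := by
  obtain ⟨z0, z1, z2, z01, z02, z12, z012, y1, y2, y3, y4⟩ := E.ne_zero
  obtain ⟨g0, g1, g2, g01, g02, g12, g012⟩ := E.gt_one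
  have A := E.act₀
  have B := E.act₁
  have C := E.act₂
  have hpos : ∀ σ τ : K ≃ₐ[ℚ] K, 0 < biNorm σ τ (x ^ 2) := fun σ τ => by
    have := (map_ne_zero (biNorm σ τ)).mpr hx
    rw [map_pow]; positivity
  have sign : ∀ (σ τ : K ≃ₐ[ℚ] K) {k₁ k₂ k₃ k₄ : ℤ}, HasSign 0 (biNorm σ τ E.e₀) →
      HasSign 0 (biNorm σ τ E.e₁) → HasSign 0 (biNorm σ τ E.e₂) → HasSign k₁ (biNorm σ τ E.w₁) →
      HasSign k₂ (biNorm σ τ E.w₂) → HasSign k₃ (biNorm σ τ E.w₃) → HasSign k₄ (biNorm σ τ E.w₄) →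
      Even (0 * a + 0 * b + 0 * c + k₁ * d₁ + k₂ * d₂ + k₃ * d₃ + k₄ * d₄) := by
    intro σ τ k₁ k₂ k₃ k₄ h0 h1 h2 h3 h4 h5 h6
    refine HasSign.even ?_ (hpos σ τ)
    rw [h, prod]
    simp only [map_mul, map_zpow₀]
    exact ((((((h0.zpow _).mul (h1.zpow _)).mul (h2.zpow _)).mul (h3.zpow _)).mul
      (h4.zpow _)).mul (h5.zpow _)).mul (h6.zpow _)
  constructor
  · have := sign S.s₀ S.s₁ (k₁ := κ₁) (k₂ := 0) (k₃ := 1) (k₄ := 0)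
      (hasSign_biNorm_of_fixed_sq z0 (by simp [B])) (hasSign_biNorm_of_neg_inv z1 (by simp [B]))
      (hasSign_biNorm_of_fixed_sq z2 (by simp [B])) ?_
      (hasSign_biNorm_of_fixed_sq y2 (by simp [E.w₂_sq, B])) ?_ ?_
    · simpa using this
    · refine hasSign_biNorm (ζ := E.e₁ ^ κ₁ * E.e₀₁) y1 (by positivity) ?_ ?_
      · rw [E.w₁_sq]
        simp only [map_mul, map_pow, B]
        exact flip_mul_sq z1 z01 κ₁
      · rw [show E.e₁ ^ κ₁ * E.e₀₁ * S.s₀ (E.e₁ ^ κ₁ * E.e₀₁) = (-1) ^ κ₁ * (E.e₁ ^ κ₁) ^ 2 by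
          simp only [map_mul, map_pow, A]; field_simp, IntermediateField.coe_mul]
        have h1 : HasSign κ₁ (((-1) ^ κ₁ : K) : ℝ) := by
          rw [HasSign, zpow_natCast]
          push_cast
          rw [← mul_pow]
          norm_num
        simpa using h1.mul (.of_pos (coe_sq_pos (pow_ne_zero κ₁ z1)))
    · refine hasSign_biNorm (ζ := E.e₁₂ * E.e₀₁₂) y3 (by positivity) ?_ ?_
      · rw [E.w₃_sq]
        simp only [map_mul, B]
        field_simp
      · refine .of_neg ?_
        rw [show E.e₁₂ * E.e₀₁₂ * S.s₀ (E.e₁₂ * E.e₀₁₂) = - E.e₁₂ ^ 2 by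
          simp only [map_mul, A]; field_simp]
        simpa using coe_sq_pos z12
    · refine hasSign_biNorm (ζ := E.e₁ * E.e₁₂) y4 (by positivity) ?_ (.of_pos ?_)
      · rw [E.w₄_sq]
        simp only [map_mul, B]
        field_simp
      · rw [show E.e₁ * E.e₁₂ * S.s₀ (E.e₁ * E.e₁₂) = (E.e₁ * E.e₁₂) ^ 2 by
          simp only [map_mul, A]; ring]
        exact coe_sq_pos (mul_ne_zero z1 z12)
  · have := sign S.s₁ S.s₂ (k₁ := 0) (k₂ := 0) (k₃ := 0) (k₄ := 1)
      (hasSign_biNorm_of_fixed_sq z0 (by simp [C])) (hasSign_biNorm_of_fixed_sq z1 (by simp [C]))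
      (hasSign_biNorm_of_neg_inv z2 (by simp [C]))
      (hasSign_biNorm_of_fixed_sq y1 (by simp [E.w₁_sq, C])) ?_ ?_ ?_
    · simpa using this
    · refine hasSign_biNorm (ζ := E.e₂ ^ κ₂ * E.e₀₂) y2 (by positivity) ?_ (.of_pos ?_)
      · rw [E.w₂_sq]
        simp only [map_mul, map_pow, C]
        exact flip_mul_sq z2 z02 κ₂
      · rw [show E.e₂ ^ κ₂ * E.e₀₂ * S.s₁ (E.e₂ ^ κ₂ * E.e₀₂) = (E.e₂ ^ κ₂ * E.e₀₂) ^ 2 by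
          simp only [map_mul, map_pow, B]; ring]
        exact coe_sq_pos (mul_ne_zero (pow_ne_zero _ z2) z02)
    · refine hasSign_biNorm (ζ := E.e₁₂ * E.e₀₁₂) y3 (by positivity) ?_ (.of_pos ?_)
      · rw [E.w₃_sq]
        simp only [map_mul, C]
        field_simp
      · rw [show E.e₁₂ * E.e₀₁₂ * S.s₁ (E.e₁₂ * E.e₀₁₂) = 1 by
          simp only [map_mul, B]; field_simp]
        simp
    · refine hasSign_biNorm (ζ := E.e₂ * E.e₁₂) y4 (by positivity) ?_ (.of_neg ?_)
      · rw [E.w₄_sq]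
        simp only [map_mul, C]
        field_simp
      · rw [show E.e₂ * E.e₁₂ * S.s₁ (E.e₂ * E.e₁₂) = - E.e₂ ^ 2 by
          simp only [map_mul, B]; field_simp]
        simpa using coe_sq_pos z2

theorem swap_prod (E : UnitData S κ₁ κ₂) (a b c d₁ d₂ d₃ d₄ : ℤ) :
    E.swap.prod a c b d₂ d₁ d₃ d₄ = E.prod a b c d₁ d₂ d₃ d₄ := by
  simp only [prod, swap]
  ring

/-- Relations between the exponents in a power product that is a square in `K`, read off from the
signs of its norms to the subfields fixed by two of the automorphisms `sᵢ`. -/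
theorem even_of_sq_eq_prod (E : UnitData S κ₁ κ₂) {x : K} (hx : x ≠ 0)
    {a b c d₁ d₂ d₃ d₄ : ℤ} (h : x ^ 2 = E.prod a b c d₁ d₂ d₃ d₄) :
    Even (κ₁ * d₁ + d₃) ∧ Even (κ₂ * d₂ + d₃) ∧ Even d₄ :=
  ⟨(E.even_of_sq_eq_prod_aux hx h).1,
    (E.swap.even_of_sq_eq_prod_aux hx (h.trans (E.swap_prod _ _ _ _ _ _ _).symm)).1,
    (E.even_of_sq_eq_prod_aux hx h).2⟩

theorem even_of_sq_eq_prod_zero (E : UnitData S κ₁ κ₂) {x : K} (hx : x ≠ 0)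
    {a b c : ℤ} (h : x ^ 2 = E.prod a b c 0 0 0 0) : Even a ∧ Even b ∧ Even c := by
  obtain ⟨g0, g1, g2, -⟩ := E.gt_one
  obtain ⟨a0, a1, a2, -⟩ := E.act₀
  obtain ⟨b0, b1, b2, -⟩ := E.act₁
  obtain ⟨c0, c1, c2, -⟩ := E.act₂
  have sign : ∀ (σ : K ≃ₐ[ℚ] K) {k₀ k₁ k₂ : ℤ}, HasSign k₀ (realConj σ E.e₀) →
      HasSign k₁ (realConj σ E.e₁) → HasSign k₂ (realConj σ E.e₂) →
      Even (k₀ * a + k₁ * b + k₂ * c) := by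
    intro σ k₀ k₁ k₂ h0 h1 h2
    refine HasSign.even (x := realConj σ (x ^ 2)) ?_ ?_
    · rw [h, prod]
      simp only [map_mul, map_zpow₀, zpow_zero, mul_one]
      exact ((h0.zpow _).mul (h1.zpow _)).mul (h2.zpow _)
    · rw [realConj_apply, map_pow]
      exact coe_sq_pos ((map_ne_zero σ).mpr hx)
  refine ⟨?_, ?_, ?_⟩
  · simpa using sign S.s₀ (hasSign_realConj_of_neg g0 a0) (hasSign_realConj_of_fixed g1 a1)
      (hasSign_realConj_of_fixed g2 a2)
  · simpa using sign S.s₁ (hasSign_realConj_of_fixed g0 b0) (hasSign_realConj_of_neg g1 b1)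
      (hasSign_realConj_of_fixed g2 b2)
  · simpa using sign S.s₂ (hasSign_realConj_of_fixed g0 c0) (hasSign_realConj_of_fixed g1 c1)
      (hasSign_realConj_of_neg g2 c2)

/-- When `ε_{2p}` has norm `1`, its square root `w₁` does not occur to an odd power in a power
product of `e₀, e₁, e₂, w₁, w₂` that is a square in `K`: otherwise `w₁` would be fixed by `s₂` and
`s₀s₁`, hence lie in `ℚ(√(2p))`. -/
theorem sq_ne_prod (E : UnitData S 0 κ₂) (hp : ¬ IsSquare (2 * p)) {x : K} {a b c d : ℤ}
    (hd : κ₂ = 0 ∨ d = 0) : x ^ 2 ≠ E.prod a b c 1 d 0 0 := by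
  intro h
  obtain ⟨z0, z1, z2, z01, z02, -, -, y1, y2, -⟩ := E.ne_zero
  obtain ⟨A0, A1, A2, A3, A4, -⟩ := E.act₀
  obtain ⟨B0, B1, B2, B3, B4, -⟩ := E.act₁
  obtain ⟨C0, C1, C2, C3, C4, -⟩ := E.act₂
  have hw1 : E.w₁ ^ 2 = E.e₀₁ := by rw [E.w₁_sq]; simp
  have hx : x ^ 4 = (E.e₀ ^ a) ^ 2 * (E.e₁ ^ b) ^ 2 * (E.e₂ ^ c) ^ 2 * E.e₀₁ * (E.w₂ ^ d) ^ 2 := by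
    rw [show x ^ 4 = (x ^ 2) ^ 2 by ring, h, ← hw1, prod, zpow_one, zpow_zero, zpow_zero]
    ring
  have hw2 : ∀ τ : K ≃ₐ[ℚ] K, τ E.e₀₂ = (-1) ^ κ₂ * E.e₀₂⁻¹ →
      (E.w₂ ^ d) ^ 2 * τ ((E.w₂ ^ d) ^ 2) = 1 := by
    intro τ hτ
    rcases hd with rfl | rfl
    · have : (E.w₂ ^ d) ^ 2 = E.e₀₂ ^ d := by
        rw [← zpow_natCast, ← zpow_mul, mul_comm, zpow_mul, zpow_natCast, E.w₂_sq]
        simp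
      rw [this, map_zpow₀, hτ, ← mul_zpow, pow_zero, one_mul, mul_inv_cancel₀ z02, one_zpow]
    · simp
  have f2 : S.s₂ E.w₁ = E.w₁ := by
    have hy : E.e₀ ^ a * E.e₁ ^ b * E.w₁ ≠ 0 := by positivity
    have h1 := fixed_of_norm_pow_four S.s₂_s₂ (x := x) hy (by
      have e2 := sq_mul_map_zpow_of_neg_inv z2 C2 c
      have e3 := hw2 S.s₂ C4
      rw [hx]
      simp only [map_mul, map_pow] at e2 e3 ⊢
      rw [map_zpow₀ S.s₂ E.e₀, map_zpow₀ S.s₂ E.e₁, C0, C1, C3]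
      linear_combination ((E.e₀ ^ a) ^ 2 * (E.e₁ ^ b) ^ 2) ^ 2 * (E.e₀₁ ^ 2 *
        (e2 * ((E.w₂ ^ d) ^ 2 * S.s₂ (E.w₂ ^ d) ^ 2) + e3) - (E.w₁ ^ 2 + E.e₀₁) * hw1))
    rw [map_mul, map_mul, map_zpow₀, map_zpow₀, C0, C1] at h1
    exact mul_left_cancel₀ (by positivity) h1
  have f01 : S.s₀ (S.s₁ E.w₁) = E.w₁ := by
    have hy : E.e₂ ^ c * E.w₁ ≠ 0 := by positivity
    have h1 := fixed_of_norm_pow_four (τ := S.s₁.trans S.s₀) (by simp) (x := x) hy (by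
      have e0 := sq_mul_map_zpow_of_neg_inv (τ := S.s₁.trans S.s₀) z0 (by simp [B0, A0]) a
      have e1 := sq_mul_map_zpow_of_neg_inv (τ := S.s₁.trans S.s₀) z1 (by simp [B1, A1]) b
      have e3 := hw2 (S.s₁.trans S.s₀) (by simp [B4, A4])
      have e4 : (S.s₁.trans S.s₀) E.e₀₁ = E.e₀₁ := by simp [B3, A3]
      have e5 : (S.s₁.trans S.s₀) E.e₂ = E.e₂ := by simp [B2, A2]
      rw [hx]
      simp only [map_mul, map_pow] at e0 e1 e3 ⊢
      rw [map_zpow₀ _ E.e₂, e4, e5]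
      set τ := S.s₁.trans S.s₀
      linear_combination ((E.e₂ ^ c) ^ 2) ^ 2 * (E.e₀₁ ^ 2 * ((e0 * (E.e₁ ^ b * τ (E.e₁ ^ b)) ^ 2
        + e1) * ((E.w₂ ^ d) ^ 2 * τ (E.w₂ ^ d) ^ 2) + e3) - (E.w₁ ^ 2 + E.e₀₁) * hw1))
    rw [map_mul, map_zpow₀] at h1
    simp only [AlgEquiv.trans_apply, B2, A2] at h1
    exact mul_left_cancel₀ (by positivity) h1
  have f01' : S.s₁ E.w₁ = S.s₀ E.w₁ := by rw [← S.s₀_s₀ (S.s₁ E.w₁), f01]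
  have hmem := S.mem_quadField_of_swaps (d := 2 * p) (by rintro h; exact hp ⟨0, h⟩)
    S.coe_r₀_mul_r₁ (v := E.w₁) (v' := S.s₀ E.w₁) (.inr ⟨by simp, rfl, by simp⟩)
    (.inr ⟨by simp, f01', by simp [f01]⟩) (.inl ⟨by simp, f2, by simp [f2]⟩)
  refine sq_ne_ε hp hmem ?_
  rw [← E.coe_e₀₁, ← hw1]
  simp

end UnitData

/-! ### Positive units as power products -/

theorem eq_of_sq_eq {x y : K} (hx : 0 < (x : ℝ)) (hy : 0 < (y : ℝ)) (h : x ^ 2 = y ^ 2) : x = y := by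
  refine Subtype.ext ((sq_eq_sq₀ hx.le hy.le).mp ?_)
  exact_mod_cast congrArg (fun z : K => (z : ℝ)) h

namespace UnitData

theorem prod_ne_zero (E : UnitData S κ₁ κ₂) (a b c d₁ d₂ d₃ d₄ : ℤ) :
    E.prod a b c d₁ d₂ d₃ d₄ ≠ 0 :=
  ne_zero_of_coe_pos (E.prod_pos _ _ _ _ _ _ _)

theorem prod_double (E : UnitData S κ₁ κ₂) (a b c d₁ d₂ d₃ d₄ : ℤ) :
    E.prod (a + a) (b + b) (c + c) (d₁ + d₁) (d₂ + d₂) (d₃ + d₃) (d₄ + d₄) =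
      E.prod a b c d₁ d₂ d₃ d₄ ^ 2 := by
  rw [prod_add, pow_two]

/-- Exponents may be reduced modulo `2`. -/
theorem exists_reduced (E : UnitData S κ₁ κ₂) {u : K} (hu : 0 < (u : ℝ)) {a b c d₁ d₂ d₃ d₄ : ℤ}
    (h : u ^ 2 = E.prod a b c d₁ d₂ d₃ d₄) : ∃ x : K, 0 < (x : ℝ) ∧
      u = x * E.prod (a / 2) (b / 2) (c / 2) (d₁ / 2) (d₂ / 2) (d₃ / 2) (d₄ / 2) ∧
      x ^ 2 = E.prod (a % 2) (b % 2) (c % 2) (d₁ % 2) (d₂ % 2) (d₃ % 2) (d₄ % 2) := by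
  set P := E.prod (a / 2) (b / 2) (c / 2) (d₁ / 2) (d₂ / 2) (d₃ / 2) (d₄ / 2) with hP
  have hP0 : P ≠ 0 := E.prod_ne_zero _ _ _ _ _ _ _
  have hPpos : 0 < (P : ℝ) := E.prod_pos _ _ _ _ _ _ _
  refine ⟨u / P, ?_, by field_simp, ?_⟩
  · push_cast; positivity
  · rw [div_pow, h, div_eq_iff (pow_ne_zero 2 hP0), hP, ← prod_double, ← prod_add]
    congr 1 <;> omega

theorem exists_eq_prod_of_sq (E : UnitData S κ₁ κ₂) {x : K} (hx : 0 < (x : ℝ)) {a b c : ℤ}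
    (h : x ^ 2 = E.prod a b c 0 0 0 0) : ∃ a b c : ℤ, x = E.prod a b c 0 0 0 0 := by
  obtain ⟨⟨a, rfl⟩, ⟨b, rfl⟩, ⟨c, rfl⟩⟩ := E.even_of_sq_eq_prod_zero (ne_zero_of_coe_pos hx) h
  refine ⟨a, b, c, eq_of_sq_eq hx (E.prod_pos _ _ _ _ _ _ _) ?_⟩
  rw [h, ← prod_double]
  rfl

/-- If `ε_{2p}` and `ε_{2q}` have norm `-1`, then a positive unit `u` of `K` is a power product of
`e₀, e₁, e₂, w₁, w₂, w₃, w₄`, possibly multiplied by the square root of a product of `w₁w₂w₃` with a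
power product of `e₀, e₁, e₂`. -/
theorem exists_eq_prod_or (E : UnitData S 1 1) (hp : p.Prime) (hq : q.Prime) (hp2 : p ≠ 2)
    (hq2 : q ≠ 2) (hpq : p ≠ q) {u : K} (hu : IsIntegralUnit u) (hpos : 0 < (u : ℝ)) :
    (∃ a b c d₁ d₂ d₃ d₄ : ℤ, u = E.prod a b c d₁ d₂ d₃ d₄) ∨
    ∃ x : K, 0 < (x : ℝ) ∧ (∃ a b c : ℕ, a ≤ 1 ∧ b ≤ 1 ∧ c ≤ 1 ∧ x ^ 2 = E.prod a b c 1 1 1 0) ∧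
      ∃ a b c d₁ d₂ d₃ d₄ : ℤ, u = x * E.prod a b c d₁ d₂ d₃ d₄ := by
  obtain ⟨a, b, c, d₁, d₂, d₃, d₄, h⟩ := E.exists_sq_eq_prod hp hq hp2 hq2 hpq hu hpos
  obtain ⟨x, hx, hux, hx2⟩ := E.exists_reduced hpos h
  obtain ⟨p13, p23, p4⟩ := E.even_of_sq_eq_prod (ne_zero_of_coe_pos hx) hx2
  simp only [Int.even_iff, Nat.cast_one, one_mul] at p13 p23 p4
  have h4 : d₄ % 2 = 0 := by omega
  rcases Int.emod_two_eq_zero_or_one d₃ with h3 | h3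
  · left
    rw [h3, h4, show d₁ % 2 = 0 by omega, show d₂ % 2 = 0 by omega] at hx2
    obtain ⟨a', b', c', h'⟩ := E.exists_eq_prod_of_sq hx hx2
    rw [h', ← prod_add] at hux
    exact ⟨_, _, _, _, _, _, _, hux⟩
  · right
    refine ⟨x, hx, ⟨(a % 2).toNat, (b % 2).toNat, (c % 2).toNat, by omega, by omega, by omega, ?_⟩,
      _, _, _, _, _, _, _, hux⟩
    rw [h3, h4, show d₁ % 2 = 1 by omega, show d₂ % 2 = 1 by omega] at hx2
    rw [hx2, Int.toNat_of_nonneg (by omega), Int.toNat_of_nonneg (by omega),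
      Int.toNat_of_nonneg (by omega)]

/-- If `ε_{2p}` has norm `-1` and `ε_{2q}` has norm `1`, then every positive unit of `K` is a power
product of `e₀, e₁, e₂, w₁, w₂, w₃, w₄`. -/
theorem exists_eq_prod_of_one_zero (E : UnitData S 1 0) (hp : p.Prime) (hq : q.Prime) (hp2 : p ≠ 2)
    (hq2 : q ≠ 2) (hpq : p ≠ q) {u : K} (hu : IsIntegralUnit u) (hpos : 0 < (u : ℝ)) :
    ∃ a b c d₁ d₂ d₃ d₄ : ℤ, u = E.prod a b c d₁ d₂ d₃ d₄ := by
  have h2q : ¬ 2 ∣ q := fun h => hq2 ((Nat.prime_dvd_prime_iff_eq Nat.prime_two hq).mp h).symm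
  obtain ⟨a, b, c, d₁, d₂, d₃, d₄, h⟩ := E.exists_sq_eq_prod hp hq hp2 hq2 hpq hu hpos
  obtain ⟨x, hx, hux, hx2⟩ := E.exists_reduced hpos h
  obtain ⟨p13, p3, p4⟩ := E.even_of_sq_eq_prod (ne_zero_of_coe_pos hx) hx2
  simp only [Int.even_iff, Nat.cast_one, Nat.cast_zero, one_mul, zero_mul, zero_add] at p13 p3 p4
  rw [show d₁ % 2 = 0 by omega, show d₃ % 2 = 0 by omega, show d₄ % 2 = 0 by omega] at hx2
  rcases Int.emod_two_eq_zero_or_one d₂ with h2 | h2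
  · rw [h2] at hx2
    obtain ⟨a', b', c', h'⟩ := E.exists_eq_prod_of_sq hx hx2
    rw [h', ← prod_add] at hux
    exact ⟨_, _, _, _, _, _, _, hux⟩
  · rw [h2, ← swap_prod] at hx2
    exact absurd hx2 (E.swap.sq_ne_prod (not_isSquare_prime_mul Nat.prime_two h2q) (.inr rfl))

/-- If `ε_{2p}` and `ε_{2q}` have norm `1`, then every positive unit of `K` is a power product of
`e₀, e₁, e₂, w₁, w₂, w₃, w₄`. -/
theorem exists_eq_prod_of_zero_zero (E : UnitData S 0 0) (hp : p.Prime) (hq : q.Prime)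
    (hp2 : p ≠ 2) (hq2 : q ≠ 2) (hpq : p ≠ q) {u : K} (hu : IsIntegralUnit u) (hpos : 0 < (u : ℝ)) :
    ∃ a b c d₁ d₂ d₃ d₄ : ℤ, u = E.prod a b c d₁ d₂ d₃ d₄ := by
  have h2p : ¬ 2 ∣ p := fun h => hp2 ((Nat.prime_dvd_prime_iff_eq Nat.prime_two hp).mp h).symm
  have h2q : ¬ 2 ∣ q := fun h => hq2 ((Nat.prime_dvd_prime_iff_eq Nat.prime_two hq).mp h).symm
  obtain ⟨a, b, c, d₁, d₂, d₃, d₄, h⟩ := E.exists_sq_eq_prod hp hq hp2 hq2 hpq hu hpos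
  obtain ⟨x, hx, hux, hx2⟩ := E.exists_reduced hpos h
  obtain ⟨-, p3, p4⟩ := E.even_of_sq_eq_prod (ne_zero_of_coe_pos hx) hx2
  simp only [Int.even_iff, Nat.cast_zero, zero_mul, zero_add] at p3 p4
  rw [show d₃ % 2 = 0 by omega, show d₄ % 2 = 0 by omega] at hx2
  rcases Int.emod_two_eq_zero_or_one d₁ with h1 | h1
  · rcases Int.emod_two_eq_zero_or_one d₂ with h2 | h2
    · rw [h1, h2] at hx2
      obtain ⟨a', b', c', h'⟩ := E.exists_eq_prod_of_sq hx hx2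
      rw [h', ← prod_add] at hux
      exact ⟨_, _, _, _, _, _, _, hux⟩
    · rw [h2, ← swap_prod] at hx2
      exact absurd hx2 (E.swap.sq_ne_prod (not_isSquare_prime_mul Nat.prime_two h2q) (.inl rfl))
  · rw [h1] at hx2
    exact absurd hx2 (E.sq_ne_prod (not_isSquare_prime_mul Nat.prime_two h2p) (.inl rfl))

/-- If a product of `w₁w₂w₃` with powers of `e₀, e₁, e₂, e₁₂` is a square in `K`, then `w₃` is
fixed by `s₁s₂`: up to powers of `e₀` and `e₁₂`, it is the relative norm of the square root. -/
theorem fixed_w₃ (E : UnitData S 1 1) {x : K} {a b c d : ℕ}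
    (h : x ^ 2 = E.e₀ ^ a * E.e₁ ^ b * E.e₂ ^ c * E.e₁₂ ^ d * E.w₁ * E.w₂ * E.w₃) :
    S.s₁ (S.s₂ E.w₃) = E.w₃ := by
  obtain ⟨z0, z1, z2, z01, z02, z12, z012, y1, y2, y3, -⟩ := E.ne_zero
  obtain ⟨B0, B1, B2, B01, B02, B12, B012⟩ := E.act₁
  obtain ⟨C0, C1, C2, C01, C02, C12, C012⟩ := E.act₂
  have hx : x ^ 4 = (E.e₀ ^ a * E.e₁ ^ b * E.e₂ ^ c * E.e₁₂ ^ d) ^ 2 * (E.e₀ * E.e₁ * E.e₀₁) *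
      (E.e₀ * E.e₂ * E.e₀₂) * (E.e₀ * E.e₁₂ * E.e₀₁₂) := by
    have h1 := E.w₁_sq
    have h2 := E.w₂_sq
    rw [pow_one] at h1 h2
    rw [show x ^ 4 = (x ^ 2) ^ 2 by ring, h, ← h1, ← h2, ← E.w₃_sq]
    ring
  have hy : E.e₀ ^ (a + 1) * E.e₁₂ ^ d * E.w₃ ≠ 0 := by positivity
  set τ := S.s₂.trans S.s₁ with hτ
  have t0 : τ E.e₀ = E.e₀ := by simp [hτ, C0, B0]
  have t1 : τ E.e₁ = -E.e₁⁻¹ := by simp [hτ, C1, B1]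
  have t2 : τ E.e₂ = -E.e₂⁻¹ := by simp [hτ, C2, B2]
  have t01 : τ E.e₀₁ = -E.e₀₁⁻¹ := by simp [hτ, C01, B01]
  have t02 : τ E.e₀₂ = -E.e₀₂⁻¹ := by simp [hτ, C02, B02]
  have t12 : τ E.e₁₂ = E.e₁₂ := by simp [hτ, C12, B12]
  have t012 : τ E.e₀₁₂ = E.e₀₁₂ := by simp [hτ, C012, B012]
  have h1 := fixed_of_norm_pow_four (τ := τ) (by simp [hτ]) (x := x) hy (by
    have f1 : E.e₀ * E.e₁ * E.e₀₁ * (E.e₀ * -E.e₁⁻¹ * -E.e₀₁⁻¹) = E.e₀ ^ 2 := by field_simp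
    have f2 : E.e₀ * E.e₂ * E.e₀₂ * (E.e₀ * -E.e₂⁻¹ * -E.e₀₂⁻¹) = E.e₀ ^ 2 := by field_simp
    have g : ∀ {y : K} (n : ℕ), y ≠ 0 → (y ^ n * (-y⁻¹) ^ n) ^ 2 = 1 := fun n hy => by
      rw [← mul_pow, mul_neg, mul_inv_cancel₀ hy, ← pow_mul, mul_comm, pow_mul, neg_one_sq, one_pow]
    rw [hx]
    simp only [map_mul, map_pow, t0, t1, t2, t01, t02, t12, t012]
    calc _ = (E.e₀ ^ a) ^ 4 * (E.e₁₂ ^ d) ^ 4 * (E.e₁ ^ b * (-E.e₁⁻¹) ^ b) ^ 2 *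
          (E.e₂ ^ c * (-E.e₂⁻¹) ^ c) ^ 2 * (E.e₀ * E.e₁ * E.e₀₁ * (E.e₀ * -E.e₁⁻¹ * -E.e₀₁⁻¹)) *
          (E.e₀ * E.e₂ * E.e₀₂ * (E.e₀ * -E.e₂⁻¹ * -E.e₀₂⁻¹)) * (E.e₀ * E.e₁₂ * E.e₀₁₂) ^ 2 := by
          ring
      _ = _ := by
          rw [f1, f2, g b z1, g c z2, ← E.w₃_sq]
          ring)
  rw [map_mul, map_mul, map_pow, map_pow, t0, t12] at h1
  exact mul_left_cancel₀ (by positivity) h1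

end UnitData

/-! ### The unit group -/

/-- The real number `x` belongs to the group generated by the nonzero elements of `T`. -/
def IsGenerated (T : Set ℝ) (x : ℝ) : Prop := ∃ g ∈ generatedBy T, (g : ℝ) = x

namespace IsGenerated

variable {T : Set ℝ} {x y : ℝ}

theorem of_mem (h : x ∈ T) (h0 : x ≠ 0) : IsGenerated T x :=
  ⟨Units.mk0 x h0, Subgroup.subset_closure h, rfl⟩

theorem mul (hx : IsGenerated T x) (hy : IsGenerated T y) : IsGenerated T (x * y) := by
  obtain ⟨g, hg, rfl⟩ := hx
  obtain ⟨g', hg', rfl⟩ := hy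
  exact ⟨g * g', mul_mem hg hg', rfl⟩

theorem zpow (hx : IsGenerated T x) (n : ℤ) : IsGenerated T (x ^ n) := by
  obtain ⟨g, hg, rfl⟩ := hx
  exact ⟨g ^ n, zpow_mem hg n, by simp⟩

end IsGenerated

theorem unitGroup_eq_generatedBy {T : Set ℝ} (hneg : (-1 : ℝ) ∈ T)
    (hT : ∀ t ∈ T, ∃ x : K, IsIntegralUnit x ∧ (x : ℝ) = t)
    (h : ∀ x : K, IsIntegralUnit x → 0 < (x : ℝ) → IsGenerated T x) :
    unitGroup K = generatedBy T := by
  apply le_antisymm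
  · intro u hu
    obtain ⟨hk, h1, h2⟩ := mem_unitGroup_iff.mp hu
    have hx : IsIntegralUnit (⟨u, hk⟩ : K) := .of_coe u.ne_zero h1 h2
    have key : IsGenerated T u := by
      rcases lt_or_gt_of_ne u.ne_zero with hneg' | hpos
      · have hx' : IsIntegralUnit (-⟨u, hk⟩ : K) :=
          ⟨neg_ne_zero.mpr hx.1, hx.2.neg, by rw [inv_neg]; exact hx.3.neg⟩
        have h3 := h _ hx' (by simpa using hneg')
        have h4 := (IsGenerated.of_mem hneg (by norm_num)).mul h3
        simpa using h4
      · exact h _ hx hpos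
    obtain ⟨g, hg, hgu⟩ := key
    rwa [← Units.ext hgu]
  · rw [generatedBy, Subgroup.closure_le]
    intro u hu
    obtain ⟨x, hx, hxu⟩ := hT u hu
    obtain ⟨-, h1, h2⟩ := hx.coe
    rw [hxu] at h1 h2
    exact mem_unitGroup_iff.mpr ⟨hxu ▸ x.2, h1, h2⟩

theorem isIntegralUnit_of_coe_eq_ε {x : K} {d : ℕ} (h : (x : ℝ) = ε d) (h1 : 1 < ε d) :
    IsIntegralUnit x :=
  .of_coe (by rw [h]; linarith) (h ▸ isIntegral_ε d) (h ▸ isIntegral_ε_inv d)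

theorem isIntegralUnit_neg_one : IsIntegralUnit (-1 : K) :=
  ⟨by simp, isIntegral_one.neg, by rw [inv_neg, inv_one]; exact isIntegral_one.neg⟩

theorem coe_eq_sqrt {x : K} {y : ℝ} (hx : 0 < (x : ℝ)) (h : (x : ℝ) ^ 2 = y) : (x : ℝ) = √y := by
  rw [← h, Real.sqrt_sq hx.le]

namespace UnitData

theorem isIntegralUnit_e (E : UnitData S κ₁ κ₂) : IsIntegralUnit E.e₀ ∧ IsIntegralUnit E.e₁ ∧
    IsIntegralUnit E.e₂ ∧ IsIntegralUnit E.e₀₁ ∧ IsIntegralUnit E.e₀₂ ∧ IsIntegralUnit E.e₁₂ ∧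
    IsIntegralUnit E.e₀₁₂ := by
  obtain ⟨h0, h1, h2, h01, h02, h12, h012⟩ := E.one_lt
  exact ⟨isIntegralUnit_of_coe_eq_ε E.coe_e₀ h0, isIntegralUnit_of_coe_eq_ε E.coe_e₁ h1,
    isIntegralUnit_of_coe_eq_ε E.coe_e₂ h2, isIntegralUnit_of_coe_eq_ε E.coe_e₀₁ h01,
    isIntegralUnit_of_coe_eq_ε E.coe_e₀₂ h02, isIntegralUnit_of_coe_eq_ε E.coe_e₁₂ h12,
    isIntegralUnit_of_coe_eq_ε E.coe_e₀₁₂ h012⟩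

theorem isIntegralUnit_w (E : UnitData S κ₁ κ₂) : IsIntegralUnit E.w₁ ∧ IsIntegralUnit E.w₂ ∧
    IsIntegralUnit E.w₃ ∧ IsIntegralUnit E.w₄ := by
  obtain ⟨h0, h1, h2, h01, h02, h12, h012⟩ := E.isIntegralUnit_e
  refine ⟨.of_sq ?_, .of_sq ?_, .of_sq ?_, .of_sq ?_⟩
  · rw [E.w₁_sq]; exact ((h0.mul h1).pow κ₁).mul h01
  · rw [E.w₂_sq]; exact ((h0.mul h2).pow κ₂).mul h02
  · rw [E.w₃_sq]; exact (h0.mul h12).mul h012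
  · rw [E.w₄_sq]; exact (h1.mul h2).mul h12

theorem isIntegralUnit_prod (E : UnitData S κ₁ κ₂) (a b c d₁ d₂ d₃ d₄ : ℤ) :
    IsIntegralUnit (E.prod a b c d₁ d₂ d₃ d₄) := by
  obtain ⟨h0, h1, h2, -⟩ := E.isIntegralUnit_e
  obtain ⟨h3, h4, h5, h6⟩ := E.isIntegralUnit_w
  exact ((((((h0.zpow a).mul (h1.zpow b)).mul (h2.zpow c)).mul (h3.zpow d₁)).mul (h4.zpow d₂)).mul
    (h5.zpow d₃)).mul (h6.zpow d₄)

theorem isGenerated_prod (E : UnitData S κ₁ κ₂) {T : Set ℝ} (h₀ : ε 2 ∈ T) (h₁ : ε p ∈ T)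
    (h₂ : ε q ∈ T) (g₁ : (E.w₁ : ℝ) ∈ T) (g₂ : (E.w₂ : ℝ) ∈ T) (g₃ : IsGenerated T E.w₃)
    (g₄ : (E.w₄ : ℝ) ∈ T) (a b c d₁ d₂ d₃ d₄ : ℤ) :
    IsGenerated T (E.prod a b c d₁ d₂ d₃ d₄ : ℝ) := by
  obtain ⟨z0, z1, z2, -⟩ := E.one_lt
  obtain ⟨y1, y2, -, y4⟩ := E.w_pos
  have hz : ∀ (x : K) (n : ℤ), ((x ^ n : K) : ℝ) = (x : ℝ) ^ n := fun x n =>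
    map_zpow₀ (algebraMap K ℝ) x n
  simp only [prod, IntermediateField.coe_mul, hz, E.coe_e₀, E.coe_e₁, E.coe_e₂]
  have G := fun {x : ℝ} (h : x ∈ T) (h0 : 0 < x) => IsGenerated.of_mem h h0.ne'
  exact (((((((G h₀ (by linarith)).zpow a).mul ((G h₁ (by linarith)).zpow b)).mul
    ((G h₂ (by linarith)).zpow c)).mul ((G g₁ y1).zpow d₁)).mul ((G g₂ y2).zpow d₂)).mul
    (g₃.zpow d₃)).mul ((G g₄ y4).zpow d₄)

theorem coe_w₃ (E : UnitData S κ₁ κ₂) :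
    (E.w₃ : ℝ) = √(ε 2 * ε (p * q) * ε (2 * p * q)) := by
  refine coe_eq_sqrt E.w_pos.2.2.1 ?_
  rw [← E.coe_e₀, ← E.coe_e₁₂, ← E.coe_e₀₁₂]
  exact_mod_cast congrArg (fun x : K => (x : ℝ)) E.w₃_sq

theorem coe_w₄ (E : UnitData S κ₁ κ₂) : (E.w₄ : ℝ) = √(ε p * ε q * ε (p * q)) := by
  refine coe_eq_sqrt E.w_pos.2.2.2 ?_
  rw [← E.coe_e₁, ← E.coe_e₂, ← E.coe_e₁₂]
  exact_mod_cast congrArg (fun x : K => (x : ℝ)) E.w₄_sq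

theorem coe_w₁ (E : UnitData S κ₁ κ₂) : (E.w₁ : ℝ) = √((ε 2 * ε p) ^ κ₁ * ε (2 * p)) := by
  refine coe_eq_sqrt E.w_pos.1 ?_
  rw [← E.coe_e₀, ← E.coe_e₁, ← E.coe_e₀₁]
  exact_mod_cast congrArg (fun x : K => (x : ℝ)) E.w₁_sq

theorem coe_w₂ (E : UnitData S κ₁ κ₂) : (E.w₂ : ℝ) = √((ε 2 * ε q) ^ κ₂ * ε (2 * q)) :=
  E.swap.coe_w₁

/-- If all positive units are power products of `e₀, e₁, e₂, w₁, w₂, w₃, w₄`, then these elements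
and `-1` generate the unit group. -/
theorem unitGroup_eq (E : UnitData S κ₁ κ₂) (h : ∀ u : K, IsIntegralUnit u → 0 < (u : ℝ) →
    ∃ a b c d₁ d₂ d₃ d₄ : ℤ, u = E.prod a b c d₁ d₂ d₃ d₄) {T : Set ℝ}
    (hT : T = {-1, ε 2, ε p, ε q, (E.w₁ : ℝ), (E.w₂ : ℝ), (E.w₃ : ℝ), (E.w₄ : ℝ)}) :
    unitGroup K = generatedBy T := by
  obtain ⟨h0, h1, h2, -⟩ := E.isIntegralUnit_e
  obtain ⟨h3, h4, h5, h6⟩ := E.isIntegralUnit_w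
  subst hT
  apply unitGroup_eq_generatedBy (by simp)
  · rintro t (rfl | rfl | rfl | rfl | rfl | rfl | rfl | rfl)
    exacts [⟨-1, isIntegralUnit_neg_one, by simp⟩, ⟨_, h0, E.coe_e₀⟩, ⟨_, h1, E.coe_e₁⟩,
      ⟨_, h2, E.coe_e₂⟩, ⟨_, h3, rfl⟩, ⟨_, h4, rfl⟩, ⟨_, h5, rfl⟩, ⟨_, h6, rfl⟩]
  · intro u hu hpos
    obtain ⟨a, b, c, d₁, d₂, d₃, d₄, rfl⟩ := h u hu hpos
    exact E.isGenerated_prod (by simp) (by simp) (by simp) (by simp) (by simp)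
      (.of_mem (by simp) E.w_pos.2.2.1.ne') (by simp) _ _ _ _ _ _ _

/-- The unit group when it contains the square root `x` of a product of `w₁w₂w₃` with powers of
`e₀, e₁, e₂`: then `x` takes the place of `w₃`. -/
theorem unitGroup_eq_of_sq_eq (E : UnitData S 1 1) (hp : p.Prime) (hq : q.Prime) (hp2 : p ≠ 2)
    (hq2 : q ≠ 2) (hpq : p ≠ q) {x : K} (hx : 0 < (x : ℝ)) {a b c : ℤ}
    (hx2 : x ^ 2 = E.prod a b c 1 1 1 0) :
    unitGroup K = generatedBy
      {-1, ε 2, ε p, ε q, (E.w₁ : ℝ), (E.w₂ : ℝ), (E.w₄ : ℝ), (x : ℝ)} := by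
  obtain ⟨h0, h1, h2, -⟩ := E.isIntegralUnit_e
  obtain ⟨h3, h4, -, h6⟩ := E.isIntegralUnit_w
  have hxu : IsIntegralUnit x := .of_sq (hx2 ▸ E.isIntegralUnit_prod _ _ _ _ _ _ _)
  apply unitGroup_eq_generatedBy (by simp)
  · rintro t (rfl | rfl | rfl | rfl | rfl | rfl | rfl | rfl)
    exacts [⟨-1, isIntegralUnit_neg_one, by simp⟩, ⟨_, h0, E.coe_e₀⟩, ⟨_, h1, E.coe_e₁⟩,
      ⟨_, h2, E.coe_e₂⟩, ⟨_, h3, rfl⟩, ⟨_, h4, rfl⟩, ⟨_, h6, rfl⟩, ⟨_, hxu, rfl⟩]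
  · set T : Set ℝ := {-1, ε 2, ε p, ε q, (E.w₁ : ℝ), (E.w₂ : ℝ), (E.w₄ : ℝ), (x : ℝ)} with hT
    have gx : IsGenerated T x := .of_mem (by simp [hT]) hx.ne'
    have gw : IsGenerated T E.w₃ := by
      have hw : E.w₃ = x ^ 2 * (E.e₀ ^ (-a) * E.e₁ ^ (-b) * E.e₂ ^ (-c) * E.w₁ ^ (-1 : ℤ) *
          E.w₂ ^ (-1 : ℤ)) := by
        obtain ⟨z0, z1, z2, -, -, -, -, z3, z4, -⟩ := E.ne_zero
        rw [hx2, prod]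
        simp only [zpow_neg, zpow_one, zpow_zero]
        field_simp
      have hw' : (E.w₃ : ℝ) = (x : ℝ) ^ (2 : ℤ) * (ε 2 ^ (-a) * ε p ^ (-b) * ε q ^ (-c) *
          (E.w₁ : ℝ) ^ (-1 : ℤ) * (E.w₂ : ℝ) ^ (-1 : ℤ)) := by
        have := congrArg (algebraMap K ℝ) hw
        simp only [map_mul, map_pow, map_zpow₀] at this
        rw [← E.coe_e₀, ← E.coe_e₁, ← E.coe_e₂]
        rw [zpow_ofNat]
        exact this
      obtain ⟨z0, z1, z2, -⟩ := E.one_lt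
      obtain ⟨y1, y2, -⟩ := E.w_pos
      have G := fun {x : ℝ} (h : x ∈ T) (h0 : 0 < x) => IsGenerated.of_mem h h0.ne'
      rw [hw']
      exact (gx.zpow 2).mul ((((((G (by simp [hT]) (by linarith)).zpow _).mul
        ((G (by simp [hT]) (by linarith)).zpow _)).mul
        ((G (by simp [hT]) (by linarith)).zpow _)).mul ((G (by simp [hT]) y1).zpow _)).mul
        ((G (by simp [hT]) y2).zpow _))
    have gprod := fun a b c d₁ d₂ d₃ d₄ => E.isGenerated_prod (T := T) (by simp [hT]) (by simp [hT])
      (by simp [hT]) (by simp [hT]) (by simp [hT]) gw (by simp [hT]) a b c d₁ d₂ d₃ d₄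
    intro u hu hpos
    rcases E.exists_eq_prod_or hp hq hp2 hq2 hpq hu hpos with
      ⟨a', b', c', d₁, d₂, d₃, d₄, rfl⟩ | ⟨y, hy, ⟨a', b', c', -, -, -, hy2⟩, i, j, k, d₁, d₂, d₃, d₄, rfl⟩
    · exact gprod _ _ _ _ _ _ _
    -- the quotient of `y` and `x` is the square root of a power product of `e₀, e₁, e₂`
    · have hx0 := ne_zero_of_coe_pos hx
      have hyx : (y / x) ^ 2 = E.prod (a' - a) (b' - b) (c' - c) 0 0 0 0 := by
        rw [div_pow, hx2, hy2, div_eq_iff (E.prod_ne_zero _ _ _ _ _ _ _), ← prod_add]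
        congr 1 <;> ring
      obtain ⟨a'', b'', c'', h''⟩ := E.exists_eq_prod_of_sq (x := y / x)
        (by push_cast; positivity) hyx
      rw [div_eq_iff hx0] at h''
      rw [h'']
      push_cast
      exact ((gprod _ _ _ _ _ _ _).mul gx).mul (gprod _ _ _ _ _ _ _)

theorem hasForm (S : FlipSystem p q (triquadField p q)) (E : UnitData S 1 1) (hp : p.Prime)
    (hq : q.Prime) (hp2 : p ≠ 2) (hq2 : q ≠ 2) (hpq : p ≠ q) :
    HasFirstForm p q ∨ HasSecondForm p q := by
  by_cases hex : ∃ x : triquadField p q, 0 < (x : ℝ) ∧ ∃ a b c : ℕ, a ≤ 1 ∧ b ≤ 1 ∧ c ≤ 1 ∧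
      x ^ 2 = E.prod a b c 1 1 1 0
  · obtain ⟨x, hx, a, b, c, ha, hb, hc, hx2⟩ := hex
    refine .inr ⟨a, b, c, 0, ha, hb, hc, zero_le_one, by simp, ?_⟩
    rw [E.unitGroup_eq_of_sq_eq hp hq hp2 hq2 hpq hx hx2]
    have hxs : (x : ℝ) = √(ε 2 ^ a * ε p ^ b * ε q ^ c * ε (p * q) ^ 0 * E.w₁ * E.w₂ * E.w₃) := by
      refine coe_eq_sqrt hx ?_
      rw [← E.coe_e₀, ← E.coe_e₁, ← E.coe_e₂]
      have := congrArg (fun y : triquadField p q => (y : ℝ)) hx2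
      simpa [prod] using this
    rw [hxs, E.coe_w₁, E.coe_w₂, E.coe_w₃, E.coe_w₄, pow_one, pow_one]
  · refine .inl (E.unitGroup_eq (fun u hu hpos => ?_) ?_)
    · rcases E.exists_eq_prod_or hp hq hp2 hq2 hpq hu hpos with h | ⟨y, hy, hy2, -⟩
      · exact h
      · exact absurd ⟨y, hy, hy2⟩ hex
    · rw [E.coe_w₁, E.coe_w₂, E.coe_w₃, E.coe_w₄, pow_one, pow_one]

theorem exists_sq_of_hasSecondForm (S : FlipSystem p q (triquadField p q)) (E : UnitData S 1 1)
    (hp : p.Prime) (hq : q.Prime) (h : HasSecondForm p q) :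
    ∃ z ∈ biquadField p q, z ^ 2 = ε 2 * ε (p * q) * ε (2 * p * q) := by
  obtain ⟨a, b, c, d, -, -, -, -, -, h⟩ := h
  set X := ε 2 ^ a * ε p ^ b * ε q ^ c * ε (p * q) ^ d * √(ε 2 * ε p * ε (2 * p)) *
    √(ε 2 * ε q * ε (2 * q)) * √(ε 2 * ε (p * q) * ε (2 * p * q)) with hX
  have hXw : X = ((E.e₀ ^ a * E.e₁ ^ b * E.e₂ ^ c * E.e₁₂ ^ d * E.w₁ * E.w₂ * E.w₃ :
      triquadField p q) : ℝ) := by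
    push_cast
    rw [hX, E.coe_w₁, E.coe_w₂, E.coe_w₃, E.coe_e₀, E.coe_e₁, E.coe_e₂, E.coe_e₁₂, pow_one, pow_one]
  obtain ⟨g0, g1, g2, -, -, g12, -⟩ := E.gt_one
  obtain ⟨y1, y2, y3, -⟩ := E.w_pos
  have hXpos : 0 < X := by
    have h0 := one_pos.trans g0
    have h1 := one_pos.trans g1
    have h2 := one_pos.trans g2
    have h12 := one_pos.trans g12
    rw [hXw]; push_cast; positivity
  -- the last generator lies in the field
  have hmem : √X ∈ triquadField p q := by
    have hu : Units.mk0 (√X) (Real.sqrt_pos.mpr hXpos).ne' ∈ unitGroup (triquadField p q) := by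
      rw [h]
      exact Subgroup.subset_closure (by simp)
    exact (mem_unitGroup_iff.mp hu).1
  have hfix := E.fixed_w₃ (x := ⟨√X, hmem⟩) (a := a) (b := b) (c := c) (d := d) (Subtype.ext (by
    rw [← hXw]
    exact Real.sq_sqrt hXpos.le))
  refine ⟨E.w₃, S.mem_biquadField hp.ne_zero hq.ne_zero hfix, ?_⟩
  rw [← E.coe_e₀, ← E.coe_e₁₂, ← E.coe_e₀₁₂]
  exact_mod_cast congrArg (fun x : triquadField p q => (x : ℝ)) E.w₃_sq

end UnitData

end MultiquadUnits

theorem theorem4p1 (p₁ p₂ : ℕ) (hp₁ : p₁.Prime) (hp₂ : p₂.Prime) (hne : p₁ ≠ p₂)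
    (h₁ : p₁ ≡ 1 [MOD 8]) (h₂ : p₂ ≡ 1 [MOD 4])
    (hn₃ : normFundUnit (p₁ * p₂) = -1) (hn₄ : normFundUnit (2 * p₁ * p₂) = -1) :
    (normFundUnit (2 * p₁) = -1 → normFundUnit (2 * p₂) = -1 →
      (HasFirstForm p₁ p₂ ∨ HasSecondForm p₁ p₂) ∧
      (HasSecondForm p₁ p₂ →
        ∃ z ∈ biquadField p₁ p₂, z ^ 2 = ε 2 * ε (p₁ * p₂) * ε (2 * p₁ * p₂))) ∧
    (normFundUnit (2 * p₁) = -1 → normFundUnit (2 * p₂) = 1 →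
      unitGroup (triquadField p₁ p₂) = generatedBy {-1, ε 2, ε p₁, ε p₂, √(ε (2 * p₂)),
        √(ε 2 * ε p₁ * ε (2 * p₁)), √(ε 2 * ε (p₁ * p₂) * ε (2 * p₁ * p₂)),
        √(ε p₁ * ε p₂ * ε (p₁ * p₂))}) ∧
    (normFundUnit (2 * p₁) = 1 → normFundUnit (2 * p₂) = 1 →
      unitGroup (triquadField p₁ p₂) = generatedBy {-1, ε 2, ε p₁, ε p₂,
        √(ε (2 * p₁)), √(ε (2 * p₂)), √(ε 2 * ε (p₁ * p₂) * ε (2 * p₁ * p₂)),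
        √(ε p₁ * ε p₂ * ε (p₁ * p₂))}) := by
  have h₁' : p₁ ≡ 1 [MOD 4] := h₁.of_dvd (by norm_num)
  have hp2 : p₁ ≠ 2 := by rintro rfl; exact absurd h₁' (by decide)
  have hq2 : p₂ ≠ 2 := by rintro rfl; exact absurd h₂ (by decide)
  obtain ⟨S⟩ := nonempty_flipSystem hp₁ hp₂ hp2 hq2 hne
  have data := fun {κ₁ κ₂ : ℕ} => nonempty_unitData S hp₁ hp₂ hp2 hq2 hne h₁' h₂ hn₃ hn₄
    (κ₁ := κ₁) (κ₂ := κ₂)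
  refine ⟨fun h₃ h₄ => ?_, fun h₃ h₄ => ?_, fun h₃ h₄ => ?_⟩
  · obtain ⟨E⟩ := data le_rfl le_rfl (by rw [h₃, pow_one]) (by rw [h₄, pow_one])
    exact ⟨UnitData.hasForm S E hp₁ hp₂ hp2 hq2 hne,
      UnitData.exists_sq_of_hasSecondForm S E hp₁ hp₂⟩
  · obtain ⟨E⟩ := data le_rfl zero_le_one (by rw [h₃, pow_one]) (by rw [h₄, pow_zero])
    refine E.unitGroup_eq
      (fun u hu hpos => E.exists_eq_prod_of_one_zero hp₁ hp₂ hp2 hq2 hne hu hpos) ?_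
    rw [E.coe_w₁, E.coe_w₂, E.coe_w₃, E.coe_w₄, pow_zero, one_mul, pow_one,
      Set.insert_comm (√(ε (2 * p₂)))]
  · obtain ⟨E⟩ := data zero_le_one zero_le_one (by rw [h₃, pow_zero]) (by rw [h₄, pow_zero])
    refine E.unitGroup_eq
      (fun u hu hpos => E.exists_eq_prod_of_zero_zero hp₁ hp₂ hp2 hq2 hne hu hpos) ?_
    rw [E.coe_w₁, E.coe_w₂, E.coe_w₃, E.coe_w₄, pow_zero, one_mul, pow_zero, one_mul]
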